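/- Let $k\ge 2$ be an integer and let $t^{1/2},t_0^{1/2},t_k^{1/2},a,a_0,a_k$ be nonzero complex numbers. For $x$ a monomial in $t,t_0,t_k$ write $[\![x]\!]=x^{1/2}+x^{-1/2}$ (with the square roots given by the chosen $t^{1/2},t_0^{1/2},t_k^{1/2}$), and let $[k]=\frac{t^{k/2}-t^{-k/2}}{t^{1/2}-t^{-1/2}}=\sum_{j=0}^{k-1}t^{(k-1-2j)/2}$. Let $\mathcal B_k$ be the group generated by $T_0,\dots,T_k$ with relations $T_iT_j=T_jT_i$ for $|i-j|>1$; $T_iT_{i+1}T_i=T_{i+1}T_iT_{i+1}$ for $1\le i\le k-2$; $T_0T_1T_0T_1=T_1T_0T_1T_0$; and $T_{k-1}T_kT_{k-1}T_k=T_kT_{k-1}T_kT_{k-1}$. The two boundary Hecke algebra $H_k$ is the quotient of $\mathbb C[\mathcal B_k]$ by $(T_0-t_0^{1/2})(T_0+t_0^{-1/2})=0$, $(T_k-t_k^{1/2})(T_k+t_k^{-1/2})=0$ and $(T_i-t^{1/2})(T_i+t^{-1/2})=0$ for $1\le i\le k-1$. Define $e_0,\dots,e_k\in H_k$ by $a_0e_0=T_0-t_0^{1/2}$,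 $a_ke_k=T_k-t_k^{1/2}$, and $ae_i=T_i-t^{1/2}$ for $1\le i\le k-1$. The two boundary Temperley-Lieb algebra $TL_k$ is the quotient of $H_k$ by the relations $$a_0a^2e_1e_0e_1=a[\![t_0t^{-1}]\!]e_1,\qquad a_ka^2e_{k-1}e_ke_{k-1}=a[\![t_kt^{-1}]\!]e_{k-1},$$ $$a^3e_ie_{i+1}e_i=ae_i,\qquad a^3e_{i+1}e_ie_{i+1}=ae_{i+1}\qquad(1\le i\le k-2).$$ Let $W_1=T_1^{-1}T_2^{-1}\cdots T_{k-1}^{-1}T_kT_{k-1}\cdots T_2T_1T_0$, let $W_{j+1}=T_jW_jT_j$ for $1\le j\le k-1$, and let $Z=W_1+W_1^{-1}+\cdots+W_k+W_k^{-1}$. Let $$I_1=\begin{cases}(ae_1)(ae_3)\cdots(ae_{k-1}),&k\text{ even},\\(ae_1)(ae_3)\cdots(ae_{k-2})\,e_k,&k\text{ odd},\end{cases}\qquad I_2=\begin{cases}e_0(ae_2)(ae_4)\cdots(ae_{k-2})\,e_k,&k\text{ even},\\e_0(ae_2)(ae_4)\cdots(ae_{k-1}),&k\text{ odd},\end{cases}$$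 $$D^{\mathrm{even}}=I_1\big(T_0^{-1}(ae_2)(ae_4)\cdots(ae_{k-2})T_k\big)I_1\quad(k\text{ even}),$$ $$D^{\mathrm{odd}}=I_2\big(T_1^{-1}T_0^{-1}T_1^{-1}(ae_3)(ae_5)\cdots(ae_{k-2})T_k\big)I_2\quad(k\text{ odd}).$$ **Theorem.** In $TL_k$: * if $k$ is even, then $D^{\mathrm{even}}=a_0a_k\,I_1I_2I_1+[\![t_0t_kt^{-1}]\!]\,I_1$ and $Z I_1=[k]\,D^{\mathrm{even}}$; * if $k$ is odd, then $D^{\mathrm{odd}}=t^{-1/2}\left(\frac{-[\![t_0]\!]}{a_0}\right)\left(a_0a_k\,I_2I_1I_2-[\![t_0t_k^{-1}]\!]\,I_2\right)$ and $t^{-1/2}\left(\frac{-[\![t_0]\!]}{a_0}\right)Z I_2=[k]\,D^{\mathrm{odd}}$. -/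

import Mathlib

namespace TwoBoundary

/-! ### The two boundary braid group -/

/-- Defining relators of the two boundary braid group on generators `0, 1, …, k` (for `k ≥ 2`):
the braid relations of the Dynkin diagram `0 ═ 1 ─ 2 ─ ⋯ ─ (k-1) ═ k`. -/
def braidRelators (k : ℕ) : Set (FreeGroup (Fin (k + 1))) :=
  {r | ∃ i j : Fin (k + 1),
    ((i : ℕ) + 1 < j ∧
      r = (.of i * .of j) * (.of j * .of i)⁻¹) ∨
    ((i : ℕ) + 1 = j ∧ 0 < (i : ℕ) ∧ (j : ℕ) < k ∧
      r = (.of i * .of j * .of i) * (.of j * .of i * .of j)⁻¹) ∨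
    ((i : ℕ) + 1 = j ∧ ((i : ℕ) = 0 ∨ (j : ℕ) = k) ∧
      r = (.of i * .of j * .of i * .of j) * (.of j * .of i * .of j * .of i)⁻¹)}

/-- The two boundary braid group `B_k`. -/
abbrev BraidGroup (k : ℕ) : Type := PresentedGroup (braidRelators k)

/-- The generator `T_i` of `B_k`; only indices `0 ≤ i ≤ k` are ever used. -/
def σ (k i : ℕ) : BraidGroup k := PresentedGroup.of (Fin.ofNat (k + 1) i)

/-- `W_1 = T_1⁻¹ T_2⁻¹ ⋯ T_{k-1}⁻¹ T_k T_{k-1} ⋯ T_2 T_1 T_0`. -/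
def murphyOne (k : ℕ) : BraidGroup k :=
  ((List.range (k - 1)).map fun i => (σ k (i + 1))⁻¹).prod * σ k k *
    ((List.range (k - 1)).reverse.map fun i => σ k (i + 1)).prod * σ k 0

/-- The Murphy elements `W_1, …, W_k`, with `W_{j+1} = T_j W_j T_j`.
(The value at index `0` is never used.) -/
def murphy (k : ℕ) : ℕ → BraidGroup k
  | 0 => 1
  | 1 => murphyOne k
  | j + 2 => σ k (j + 1) * murphy k (j + 1) * σ k (j + 1)

/-! ### The two boundary Hecke algebra -/

/-- The parameters: arbitrary nonzero complex numbers. `rt`, `rt0`, `rtk` are the chosen square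
roots `t^{1/2}`, `t_0^{1/2}`, `t_k^{1/2}`, and `a`, `a0`, `ak` are the normalizing constants
`a`, `a_0`, `a_k` of the generators `e_i`. -/
structure Params where
  rt : ℂ
  rt0 : ℂ
  rtk : ℂ
  a : ℂ
  a0 : ℂ
  ak : ℂ
  rt_ne : rt ≠ 0
  rt0_ne : rt0 ≠ 0
  rtk_ne : rtk ≠ 0
  a_ne : a ≠ 0
  a0_ne : a0 ≠ 0
  ak_ne : ak ≠ 0

/-- `⟦x⟧ = x^{1/2} + x^{-1/2}`, as a function of the square root `u = x^{1/2}`. -/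
noncomputable def bracket (u : ℂ) : ℂ := u + u⁻¹

/-- The quantum integer `[n] = (t^{n/2} - t^{-n/2}) / (t^{1/2} - t^{-1/2})`, written as the
Laurent polynomial `∑_{j<n} u^{n-1-2j}` in `u = t^{1/2}`, so that it makes sense at `t = 1`. -/
noncomputable def qInt (u : ℂ) (n : ℕ) : ℂ :=
  ∑ j ∈ Finset.range n, u ^ ((n : ℤ) - 1 - 2 * j)

/-- The square root of the parameter attached to the vertex `i`. -/
def Params.root (p : Params) (k i : ℕ) : ℂ :=
  if i = 0 then p.rt0 else if i = k then p.rtk else p.rt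

/-- The normalizing constant attached to the vertex `i`. -/
def Params.scale (p : Params) (k i : ℕ) : ℂ :=
  if i = 0 then p.a0 else if i = k then p.ak else p.a

/-- The quadratic relations `(T_i - t_i^{1/2}) (T_i + t_i^{-1/2}) = 0`, where `t_i = t` for
`1 ≤ i ≤ k - 1`. -/
inductive HeckeRel (p : Params) (k : ℕ) :
    MonoidAlgebra ℂ (BraidGroup k) → MonoidAlgebra ℂ (BraidGroup k) → Prop
  | quadratic (i : ℕ) (hi : i ≤ k) :
      HeckeRel p k
        ((MonoidAlgebra.of ℂ (BraidGroup k) (σ k i) - algebraMap ℂ _ (p.root k i)) *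
          (MonoidAlgebra.of ℂ (BraidGroup k) (σ k i) + algebraMap ℂ _ (p.root k i)⁻¹))
        0

/-- The two boundary Hecke algebra `H_k`: the group algebra of `B_k` modulo the quadratic
relations. -/
abbrev Hecke (p : Params) (k : ℕ) : Type := RingQuot (HeckeRel p k)

/-- The image of the braid group in `H_k`. -/
noncomputable def toHecke (p : Params) (k : ℕ) : BraidGroup k →* Hecke p k :=
  (RingQuot.mkAlgHom ℂ (HeckeRel p k) : MonoidAlgebra ℂ (BraidGroup k) →* Hecke p k).comp
    (MonoidAlgebra.of ℂ (BraidGroup k))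

/-- The elements `e_i` of `H_k`, given by `a_0 e_0 = T_0 - t_0^{1/2}`, `a e_i = T_i - t^{1/2}` for
`1 ≤ i ≤ k - 1`, and `a_k e_k = T_k - t_k^{1/2}`. -/
noncomputable def heckeE (p : Params) (k i : ℕ) : Hecke p k :=
  (p.scale k i)⁻¹ • (toHecke p k (σ k i) - algebraMap ℂ _ (p.root k i))

/-- `Z = W_1 + W_1⁻¹ + ⋯ + W_k + W_k⁻¹` in `H_k`. -/
noncomputable def heckeZ (p : Params) (k : ℕ) : Hecke p k :=
  ∑ j ∈ Finset.Icc 1 k, (toHecke p k (murphy k j) + toHecke p k (murphy k j)⁻¹)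

/-! ### The two boundary Temperley-Lieb algebra -/

/-- The relations imposed on `H_k` to obtain the two boundary Temperley-Lieb algebra. -/
inductive TLRel (p : Params) (k : ℕ) : Hecke p k → Hecke p k → Prop
  | left :
      TLRel p k ((p.a0 * p.a ^ 2) • (heckeE p k 1 * heckeE p k 0 * heckeE p k 1))
        ((p.a * bracket (p.rt0 * p.rt⁻¹)) • heckeE p k 1)
  | right :
      TLRel p k ((p.ak * p.a ^ 2) • (heckeE p k (k - 1) * heckeE p k k * heckeE p k (k - 1)))
        ((p.a * bracket (p.rtk * p.rt⁻¹)) • heckeE p k (k - 1))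
  | up (i : ℕ) (h1 : 1 ≤ i) (h2 : i + 2 ≤ k) :
      TLRel p k (p.a ^ 3 • (heckeE p k i * heckeE p k (i + 1) * heckeE p k i))
        (p.a • heckeE p k i)
  | down (i : ℕ) (h1 : 1 ≤ i) (h2 : i + 2 ≤ k) :
      TLRel p k (p.a ^ 3 • (heckeE p k (i + 1) * heckeE p k i * heckeE p k (i + 1)))
        (p.a • heckeE p k (i + 1))

/-- The two boundary Temperley-Lieb algebra `TL_k` (for `k ≥ 2`). -/
abbrev TL (p : Params) (k : ℕ) : Type := RingQuot (TLRel p k)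

/-- The quotient map `H_k → TL_k`. -/
noncomputable def toTL (p : Params) (k : ℕ) : Hecke p k →ₐ[ℂ] TL p k :=
  RingQuot.mkAlgHom ℂ (TLRel p k)

/-- `T_i` in `TL_k`. -/
noncomputable def T (p : Params) (k i : ℕ) : TL p k := toTL p k (toHecke p k (σ k i))

/-- `T_i⁻¹` in `TL_k`. -/
noncomputable def Tinv (p : Params) (k i : ℕ) : TL p k := toTL p k (toHecke p k (σ k i)⁻¹)

/-- `e_i` in `TL_k`. -/
noncomputable def e (p : Params) (k i : ℕ) : TL p k := toTL p k (heckeE p k i)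

/-- `a e_i` in `TL_k`. -/
noncomputable def ae (p : Params) (k i : ℕ) : TL p k := p.a • e p k i

/-- `Z` in `TL_k`. -/
noncomputable def Z (p : Params) (k : ℕ) : TL p k := toTL p k (heckeZ p k)

/-- The ordered product `(a e_m) (a e_{m+2}) ⋯ (a e_{m+2(n-1)})` of `n` factors. -/
noncomputable def aeProd (p : Params) (k m n : ℕ) : TL p k :=
  ((List.range n).map fun j => ae p k (m + 2 * j)).prod

/-- `I_1 = (ae_1)(ae_3)⋯(ae_{k-1})` for `k` even, and
`I_1 = (ae_1)(ae_3)⋯(ae_{k-2}) e_k` for `k` odd. -/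
noncomputable def I₁ (p : Params) (k : ℕ) : TL p k :=
  if Even k then aeProd p k 1 (k / 2) else aeProd p k 1 (k / 2) * e p k k

/-- `I_2 = e_0 (ae_2)(ae_4)⋯(ae_{k-2}) e_k` for `k` even, and
`I_2 = e_0 (ae_2)(ae_4)⋯(ae_{k-1})` for `k` odd. -/
noncomputable def I₂ (p : Params) (k : ℕ) : TL p k :=
  if Even k then e p k 0 * aeProd p k 2 (k / 2 - 1) * e p k k
  else e p k 0 * aeProd p k 2 (k / 2)

/-- For `k` even, `D^even = I_1 (T_0⁻¹ (ae_2)(ae_4)⋯(ae_{k-2}) T_k) I_1`. -/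
noncomputable def Deven (p : Params) (k : ℕ) : TL p k :=
  I₁ p k * (Tinv p k 0 * aeProd p k 2 (k / 2 - 1) * T p k k) * I₁ p k

/-- For `k ≥ 3` odd, `D^odd = I_2 (T_1⁻¹ T_0⁻¹ T_1⁻¹ (ae_3)(ae_5)⋯(ae_{k-2}) T_k) I_2`. -/
noncomputable def Dodd (p : Params) (k : ℕ) : TL p k :=
  I₂ p k * (Tinv p k 1 * Tinv p k 0 * Tinv p k 1 * aeProd p k 3 (k / 2 - 1) * T p k k) * I₂ p k

end TwoBoundary

namespace TwoBoundary

/-! ### Calculus of the shifted generators. -/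

section Abstract

variable {F A : Type*} [Field F] [Ring A] [Algebra F A]

/-! Put `E_i = T_i - t_i^{1/2}`, so that `T_i` and its inverse are `E_i` shifted by a root `u`, `v`,
`w` of `t`, `t_0`, `t_k` and by its inverse. Everything then follows from the Temperley-Lieb
relations among the `E_i` (`IsTL`), which survive inverting `u`, `v`, `w` together (`IsTL.bar`).

Two local identities govern the Murphy elements: `(W_j + W_{j+1}) E_j = -u⁻¹ E_j W_j E_j`, and
`E_{j+2} W_{j+2} = u² E_j W_j` when both sides act on `E_j E_{j+2}`. Hence on a product `P = E_m
E_{m+2} ⋯` the pair `W_{m+2n} + W_{m+2n+1}` acts as `-u⁻¹ u^{2n} E_m W_m P`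
(`murphy_add_murphy_mul_stepProd`). The inverses obey the same recursion with `u⁻¹`, so only the
bottom of the chain remains.

For even `k`, take `m = 1`. Sliding arcs through crossings (`conjIter_mul_stepProd`) gives `E_1 W_1
I_1 = -u² D`. For the inverse it gives `-u⁻²` times the sandwich with `(v⁻¹, w)` replaced by `(v,
w⁻¹)`; expanding by the zigzag relations (`even_sandwich`) shows that this is again `D`. The pairs
contribute `u^{2n+1} + u^{-2n-1}`, which add up to `[k]`.

For odd `k`, take `m = 2`. The unpaired `W_1 + W_1⁻¹` produces the bracketed combination of `I_2 I_1
I_2` and `I_2`, up to normalization (`murphyOne_add_inv_mul_of_odd`). Moving the arc of `E_2` past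
the left pole (`braid_pole`, `pole_braid`) reduces the pairs to sandwiches that `odd_sandwich`
evaluates to the same combination, with coefficients `u^{2n+2} + u^{-2n-2}`. With the initial 1 they
again add up to `[k]`. -/

/-- The element `e + x`, for a scalar `x`. -/
def shift (x : F) (e : A) : A := e + x • 1

lemma Commute.shift_left {e f : A} (h : Commute e f) (x : F) : Commute (shift x e) f :=
  h.add_left ((Commute.one_left f).smul_left x)

lemma Commute.shift_right {e f : A} (h : Commute e f) (x : F) : Commute e (shift x f) :=
  (Commute.shift_left h.symm x).symm

lemma shift_mul_shift_inv {x : F} (hx : x ≠ 0) {e : A} (he : e * e = -(x + x⁻¹) • e) :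
    shift x e * shift x⁻¹ e = 1 := by
  simp only [shift, add_mul, mul_add, smul_mul_assoc, mul_smul_comm, one_mul, mul_one, he]
  match_scalars <;> (field_simp; try ring)

lemma shift_inv_mul_shift {x : F} (hx : x ≠ 0) {e : A} (he : e * e = -(x + x⁻¹) • e) :
    shift x⁻¹ e * shift x e = 1 := by
  simp only [shift, add_mul, mul_add, smul_mul_assoc, mul_smul_comm, one_mul, mul_one, he]
  match_scalars <;> (field_simp; try ring)

lemma shift_mul_self {x : F} {e : A} (he : e * e = -(x + x⁻¹) • e) :
    shift x e * e = -x⁻¹ • e := by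
  simp only [shift, add_mul, smul_mul_assoc, one_mul, he]
  module

lemma self_mul_shift {x : F} {e : A} (he : e * e = -(x + x⁻¹) • e) :
    e * shift x e = -x⁻¹ • e := by
  simp only [shift, mul_add, mul_smul_comm, mul_one, he]
  module

/-- An arc slides through two crossings at the cost of a factor `u`: the multiples of `e` in the
expansion, `1`, `-u² - 1` and `u²`, cancel. -/
lemma shift_shift_mul {u : F} (hu : u ≠ 0) {e f : A} (he : e * e = -(u + u⁻¹) • e)
    (hf : e * f * e = e) : shift u e * shift u f * e = u • (f * e) := by
  simp only [shift, add_mul, mul_add, smul_mul_assoc, mul_smul_comm, one_mul, mul_one, he, hf]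
  match_scalars <;> (field_simp; try ring)

lemma mul_shift_shift {u : F} (hu : u ≠ 0) {e f : A} (he : e * e = -(u + u⁻¹) • e)
    (hf : e * f * e = e) : e * shift u f * shift u e = u • (e * f) := by
  simp only [shift, add_mul, mul_add, smul_mul_assoc, mul_smul_comm, mul_one, he, hf]
  match_scalars <;> (field_simp; try ring)

/-- The scalar in the boundary relation is the one for which the multiples of `e` collapse to `u
v⁻¹`. Hence pulling an arc round the pole inverts the pole generator. -/
lemma shift_shift_mul_pole {u v : F} (hu : u ≠ 0) (hv : v ≠ 0) {e f : A}
    (he : e * e = -(u + u⁻¹) • e) (hf : e * f * e = (v * u⁻¹ + u * v⁻¹) • e) :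
    shift u e * shift v f * e = u • (shift v⁻¹ f * e) := by
  simp only [shift, add_mul, mul_add, smul_mul_assoc, mul_smul_comm, one_mul, mul_one, he, hf]
  match_scalars <;> (field_simp; try ring)

lemma mul_shift_shift_pole {u v : F} (hu : u ≠ 0) (hv : v ≠ 0) {e f : A}
    (he : e * e = -(u + u⁻¹) • e) (hf : e * f * e = (v * u⁻¹ + u * v⁻¹) • e) :
    e * shift v f * shift u e = u • (e * shift v⁻¹ f) := by
  simp only [shift, add_mul, mul_add, smul_mul_assoc, mul_smul_comm, mul_one, he, hf]
  match_scalars <;> (field_simp; try ring)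

/-- The cubic braid relation is a consequence of the Temperley-Lieb relations, so `IsTL` need not
contain it. -/
lemma shift_braid {u : F} (hu : u ≠ 0) {e f : A} (he : e * e = -(u + u⁻¹) • e)
    (hf : f * f = -(u + u⁻¹) • f) (hef : e * f * e = e) (hfe : f * e * f = f) :
    shift u e * shift u f * shift u e = shift u f * shift u e * shift u f := by
  simp only [shift, add_mul, mul_add, smul_mul_assoc, mul_smul_comm, one_mul, mul_one, he, hef, hf,
    hfe]
  match_scalars <;> (field_simp; try ring)

/-- The ordered product `E_m E_{m+2} ⋯ E_{m+2(n-1)}` of `n` factors. -/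
def stepProd (E : ℕ → A) (m n : ℕ) : A := ((List.range n).map fun j => E (m + 2 * j)).prod

@[simp] lemma stepProd_zero (E : ℕ → A) (m : ℕ) : stepProd E m 0 = 1 := rfl

lemma stepProd_succ (E : ℕ → A) (m n : ℕ) :
    stepProd E m (n + 1) = stepProd E m n * E (m + 2 * n) := by
  simp [stepProd, List.range_succ]

lemma stepProd_succ' (E : ℕ → A) (m n : ℕ) :
    stepProd E m (n + 1) = E m * stepProd E (m + 2) n := by
  simp only [stepProd, List.range_succ_eq_map, List.map_cons, List.map_map, List.prod_cons]
  congr 3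
  funext j
  simp only [Function.comp]
  congr 1
  omega

lemma stepProd_congr {E E' : ℕ → A} {m n : ℕ} (h : ∀ j < n, E (m + 2 * j) = E' (m + 2 * j)) :
    stepProd E m n = stepProd E' m n := by
  unfold stepProd
  congr 1
  apply List.map_congr_left
  intro j hj
  exact h j (List.mem_range.1 hj)

lemma commute_stepProd {E : ℕ → A} {x : A} {m n : ℕ}
    (h : ∀ j < n, Commute x (E (m + 2 * j))) : Commute x (stepProd E m n) := by
  induction n with
  | zero => exact Commute.one_right x
  | succ n ih =>
    rw [stepProd_succ]
    exact (ih fun j hj => h j (by omega)).mul_right (h n (by omega))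

/-- The relations of the two boundary Temperley-Lieb algebra, in terms of the rescaled generators
`E_i = T_i - t_i^{1/2}`, with `u`, `v`, `w` the square roots of `t`, `t_0`, `t_k`. -/
structure IsTL (k : ℕ) (u v w : F) (E : ℕ → A) : Prop where
  u_ne : u ≠ 0
  v_ne : v ≠ 0
  w_ne : w ≠ 0
  comm : ∀ {i j : ℕ}, i + 1 < j → j ≤ k → Commute (E i) (E j)
  sq : ∀ {i : ℕ}, 1 ≤ i → i < k → E i * E i = -(u + u⁻¹) • E i
  sq_zero : E 0 * E 0 = -(v + v⁻¹) • E 0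
  sq_last : E k * E k = -(w + w⁻¹) • E k
  left : E 1 * E 0 * E 1 = (v * u⁻¹ + u * v⁻¹) • E 1
  right : E (k - 1) * E k * E (k - 1) = (w * u⁻¹ + u * w⁻¹) • E (k - 1)
  up : ∀ {i : ℕ}, 1 ≤ i → i + 2 ≤ k → E i * E (i + 1) * E i = E i
  down : ∀ {i : ℕ}, 1 ≤ i → i + 2 ≤ k → E (i + 1) * E i * E (i + 1) = E (i + 1)

/-- The iterated conjugate `T_m⁻¹ ⋯ T_{m+n-1}⁻¹ Y T_{m+n-1} ⋯ T_m`. -/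
def conjIter (u : F) (E : ℕ → A) (Y : A) : ℕ → ℕ → A
  | _, 0 => Y
  | m, n + 1 => shift u⁻¹ (E m) * conjIter u E Y (m + 1) n * shift u (E m)

namespace IsTL

variable {k : ℕ} {u v w : F} {E : ℕ → A}

/-- Every scalar in the relations is invariant under simultaneous inversion of the parameters. Each
identity for the `T_i` thus yields one for the inverses. -/
lemma bar (h : IsTL k u v w E) : IsTL k u⁻¹ v⁻¹ w⁻¹ E where
  u_ne := inv_ne_zero h.u_ne
  v_ne := inv_ne_zero h.v_ne
  w_ne := inv_ne_zero h.w_ne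
  comm := h.comm
  sq := fun h1 h2 => by rw [h.sq h1 h2, inv_inv, add_comm]
  sq_zero := by rw [h.sq_zero, inv_inv, add_comm]
  sq_last := by rw [h.sq_last, inv_inv, add_comm]
  left := by rw [h.left, inv_inv, inv_inv]; congr 1; ring
  right := by rw [h.right, inv_inv, inv_inv]; congr 1; ring
  up := h.up
  down := h.down

/-! ### Zigzag collapse of interleaved products. -/

/-- Zigzags `E_i E_{i+1} E_i = E_i` are straightened from the left end, one per induction step,
leaving `Y` enclosed only by the rightmost factor. `stepProd_cascade_right` is the mirror image,
with `Y` left at the left end. -/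
lemma stepProd_cascade_left (h : IsTL k u v w E) (Y : A) (n : ℕ) : ∀ m : ℕ, 1 ≤ m →
    m + 2 * n < k → (∀ j < n, Commute Y (E (m + 2 * j))) →
    stepProd E m (n + 1) * stepProd E (m + 1) n * Y * stepProd E m (n + 1) =
      stepProd E m n * (E (m + 2 * n) * Y * E (m + 2 * n)) := by
  induction n with
  | zero =>
    intro m hm hk hY
    simp [stepProd_succ]
  | succ n ih =>
    intro m hm hk hY
    have ih' := ih (m + 2) (by omega) (by omega) fun j hj => by
      have := hY (j + 1) (by omega)
      rwa [show m + 2 * (j + 1) = m + 2 + 2 * j by ring] at this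
    have c1 : Commute (E m) (stepProd E (m + 2) (n + 1)) :=
      commute_stepProd fun j hj => h.comm (by omega) (by omega)
    have c2 : Commute (E m) (stepProd E (m + 3) n) :=
      commute_stepProd fun j hj => h.comm (by omega) (by omega)
    have c3 : Commute (E m) Y := (hY 0 (by omega)).symm
    rw [stepProd_succ' E m (n + 1), stepProd_succ' E (m + 1) n, stepProd_succ' E m n,
      show m + 2 * (n + 1) = m + 2 + 2 * n by ring, mul_assoc (E m) (stepProd E (m + 2) n), ← ih']
    generalize stepProd E (m + 2) (n + 1) = P at *
    rw [show m + 1 + 2 = m + 3 by ring, show m + 2 + 1 = m + 3 by ring]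
    generalize stepProd E (m + 3) n = Q at *
    calc E m * P * (E (m + 1) * Q) * Y * (E m * P)
        = (E m * P) * (E (m + 1) * Q * (Y * E m) * P) := by simp only [mul_assoc]
      _ = (P * E m) * (E (m + 1) * (Q * E m) * Y * P) := by
        rw [c1.eq, ← c3.eq]; simp only [mul_assoc]
      _ = P * (E m * E (m + 1) * E m) * Q * Y * P := by rw [← c2.eq]; simp only [mul_assoc]
      _ = (P * E m) * Q * Y * P := by rw [h.up hm (by omega)]
      _ = E m * (P * Q * Y * P) := by rw [← c1.eq]; simp only [mul_assoc]

lemma stepProd_cascade_right (h : IsTL k u v w E) (Y : A) (m n : ℕ) (hm : 1 ≤ m)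
    (hk : m + 2 * n < k) (hY : ∀ j < n, Commute Y (E (m + 2 + 2 * j))) :
    stepProd E m (n + 1) * (Y * stepProd E (m + 1) n) * stepProd E m (n + 1) =
      E m * Y * E m * stepProd E (m + 2) n := by
  induction n with
  | zero => simp [stepProd_succ]
  | succ n ih =>
    have ih' := ih (by omega) fun j hj => hY j (by omega)
    have c1 : Commute (E (m + 2 + 2 * n)) (stepProd E m (n + 1)) :=
      commute_stepProd fun j hj => (h.comm (by omega) (by omega)).symm
    have c2 : Commute (E (m + 2 + 2 * n)) (stepProd E (m + 1) n) :=
      commute_stepProd fun j hj => (h.comm (by omega) (by omega)).symm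
    have c3 : Commute Y (E (m + 2 + 2 * n)) := hY n (by omega)
    have hd := h.down (i := m + 1 + 2 * n) (by omega) (by omega)
    rw [stepProd_succ E m (n + 1), stepProd_succ E (m + 1) n, stepProd_succ E (m + 2) n,
      ← mul_assoc _ (stepProd E (m + 2) n), ← ih',
      show m + 2 * (n + 1) = m + 2 + 2 * n by ring]
    rw [show m + 1 + 2 * n + 1 = m + 2 + 2 * n by ring] at hd
    generalize stepProd E m (n + 1) = P at *
    generalize stepProd E (m + 1) n = Q at *
    generalize E (m + 2 + 2 * n) = e at *
    generalize E (m + 1 + 2 * n) = f at *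
    calc P * e * (Y * (Q * f)) * (P * e) = P * (e * Y) * Q * f * (P * e) := by
          simp only [mul_assoc]
      _ = P * Y * (e * Q) * f * (e * P) := by rw [← c3.eq, c1.eq]; simp only [mul_assoc]
      _ = P * Y * Q * (e * f * e) * P := by rw [c2.eq]; simp only [mul_assoc]
      _ = P * Y * Q * (e * P) := by rw [hd]; simp only [mul_assoc]
      _ = P * (Y * Q) * P * e := by rw [c1.eq]; simp only [mul_assoc]

/-- The case `Y = 1` of the cascade: all zigzags straighten and one closed loop remains. -/
lemma stepProd_loop (h : IsTL k u v w E) (m n : ℕ) (hm : 1 ≤ m) (hk : m + 2 * n < k) :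
    stepProd E m (n + 1) * stepProd E (m + 1) n * stepProd E m (n + 1) =
      -(u + u⁻¹) • stepProd E m (n + 1) := by
  have := h.stepProd_cascade_left 1 n m hm hk fun _ _ => Commute.one_left _
  rw [mul_one, mul_one, h.sq (by omega) hk, mul_smul_comm, ← stepProd_succ] at this
  exact this

/-! ### Iterated conjugates. -/

lemma commute_conjIter (Y : A) {x : A} (hY : Commute x Y) (n : ℕ) :
    ∀ m, (∀ j < n, Commute x (E (m + j))) → Commute x (conjIter u E Y m n) := by
  induction n with
  | zero => intro m _; exact hY
  | succ n ih =>
    intro m hx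
    have h0 : Commute x (E m) := hx 0 (by omega)
    refine ((Commute.shift_right h0 _).mul_right (ih (m + 1) fun j hj => ?_)).mul_right
      (Commute.shift_right h0 _)
    have := hx (j + 1) (by omega)
    rwa [show m + (j + 1) = m + 1 + j by ring] at this

/-- The arcs on the right absorb all crossings of the conjugate. Two layers are removed at a time:
sliding the arc `E_{m+1}` through the right-hand crossings costs `u` and creates `E_m`. This passes
through the inner conjugate and slides through the left-hand crossings at cost `u⁻¹`. -/
lemma conjIter_mul_stepProd (h : IsTL k u v w E) (Y : A)
    (hY : ∀ i, i + 1 < k → Commute Y (E i)) (n : ℕ) : ∀ m, 1 ≤ m → m + 2 * n = k →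
    conjIter u E Y m (2 * n) * stepProd E (m + 1) n =
      stepProd E (m + 1) n * stepProd E m n * Y * stepProd E (m + 1) n := by
  induction n with
  | zero => intro m _ _; simp [conjIter]
  | succ n ih =>
    intro m hm hk
    have ih' := ih (m + 2) (by omega) (by omega)
    have c1 : Commute (E (m + 1)) (stepProd E (m + 3) n) :=
      commute_stepProd fun j hj => h.comm (by omega) (by omega)
    have c2 : Commute (E m) (stepProd E (m + 3) n) :=
      commute_stepProd fun j hj => h.comm (by omega) (by omega)
    have c3 : Commute (E m) (conjIter u E Y (m + 2) (2 * n)) :=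
      commute_conjIter Y (hY m (by omega)).symm _ _ fun j hj => h.comm (by omega) (by omega)
    have h1 := shift_shift_mul h.u_ne (h.sq (i := m + 1) (by omega) (by omega))
      (h.down hm (by omega))
    have h2 := shift_shift_mul h.bar.u_ne (h.bar.sq hm (by omega)) (h.up hm (by omega))
    rw [stepProd_succ' E (m + 1) n, stepProd_succ' E m n, show 2 * (n + 1) = 2 * n + 1 + 1 by ring,
      conjIter, conjIter]
    simp only [show m + 1 + 1 = m + 2 by ring, show m + 1 + 2 = m + 3 by ring] at *
    generalize stepProd E (m + 3) n = P at *
    generalize stepProd E (m + 2) n = Q at *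
    generalize conjIter u E Y (m + 2) (2 * n) = C at *
    set a := E m
    set b := E (m + 1)
    calc shift u⁻¹ a * (shift u⁻¹ b * C * shift u b) * shift u a * (b * P)
        = shift u⁻¹ a * shift u⁻¹ b * C * (shift u b * shift u a * b) * P := by
          simp only [mul_assoc]
      _ = u • (shift u⁻¹ a * shift u⁻¹ b * (C * a) * (b * P)) := by
          rw [h1]; simp only [mul_assoc, mul_smul_comm, smul_mul_assoc]
      _ = u • ((shift u⁻¹ a * shift u⁻¹ b * a) * (C * P) * b) := by
          rw [← c3.eq, c1.eq]; simp only [mul_assoc]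
      _ = b * (a * P) * Q * Y * (P * b) := by
          rw [h2, ih', smul_mul_assoc, smul_mul_assoc, smul_smul, mul_inv_cancel₀ h.u_ne, one_smul]
          simp only [mul_assoc]
      _ = b * P * (a * Q) * Y * (b * P) := by
          rw [c2.eq, ← c1.eq]; simp only [mul_assoc]

/-- `E_i` commutes with `T_m⁻¹ ⋯ T_{k-1}⁻¹ Y T_{k-1} ⋯ T_m` for `m < i < k`. -/
lemma commute_conjIter_of_lt (h : IsTL k u v w E) (Y : A)
    (hY : ∀ i, i + 1 < k → Commute Y (E i)) (n : ℕ) : ∀ m i, 1 ≤ m → m + n = k → m < i → i < k →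
    Commute (E i) (conjIter u E Y m n) := by
  induction n with
  | zero => intro m i _ _ _ _; omega
  | succ n ih =>
    intro m i hm hk hi hik
    rcases Nat.lt_or_ge (m + 1) i with hi' | hi'
    · have c : Commute (E i) (E m) := (h.comm (by omega) (by omega)).symm
      exact ((Commute.shift_right c _).mul_right (ih (m + 1) i (by omega) (by omega) hi'
        hik)).mul_right (Commute.shift_right c _)
    -- The adjacent case: `E_{m+1}` turns into `E_m` on crossing the two inverse generators, passes
    -- through the inner conjugate, and turns back into `E_{m+1}` on the other side.
    · obtain rfl : i = m + 1 := by omega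
      obtain ⟨n, rfl⟩ : ∃ l, n = l + 1 := ⟨n - 1, by omega⟩
      have c3 : Commute (E m) (conjIter u E Y (m + 2) n) :=
        commute_conjIter Y (hY m (by omega)).symm _ _ fun j hj => h.comm (by omega) (by omega)
      have sm := h.sq hm (by omega)
      have sm1 := h.sq (i := m + 1) (by omega) (by omega)
      have h1 := shift_shift_mul h.u_ne sm1 (h.down hm (by omega))
      have h2 := mul_shift_shift h.u_ne sm (h.up hm (by omega))
      have h3 := shift_shift_mul h.bar.u_ne (h.bar.sq hm (by omega)) (h.up hm (by omega))
      have h4 := mul_shift_shift h.bar.u_ne (h.bar.sq (i := m + 1) (by omega) (by omega))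
        (h.down hm (by omega))
      rw [conjIter, conjIter]
      simp only [show m + 1 + 1 = m + 2 by ring]
      generalize conjIter u E Y (m + 2) n = C at *
      set a := E m
      set b := E (m + 1)
      calc b * (shift u⁻¹ a * (shift u⁻¹ b * C * shift u b) * shift u a)
          = (b * shift u⁻¹ a * shift u⁻¹ b) * C * shift u b * shift u a := by
            simp only [mul_assoc]
        _ = shift u⁻¹ a * shift u⁻¹ b * (a * C) * shift u b * shift u a := by
            rw [h4, ← h3]; simp only [mul_assoc]
        _ = shift u⁻¹ a * shift u⁻¹ b * C * (a * shift u b * shift u a) := by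
            rw [c3.eq]; simp only [mul_assoc]
        _ = shift u⁻¹ a * (shift u⁻¹ b * C * shift u b) * shift u a * b := by
            rw [h2, ← h1]; simp only [mul_assoc]

end IsTL
end Abstract
end TwoBoundary

namespace TwoBoundary

section Abstract

variable {F A : Type*} [Field F] [Ring A] [Algebra F A]

lemma stepProd_add (E : ℕ → A) (m a b : ℕ) :
    stepProd E m (a + b) = stepProd E m a * stepProd E (m + 2 * a) b := by
  induction b with
  | zero => simp
  | succ b ih =>
    rw [← add_assoc, stepProd_succ, stepProd_succ, ih, mul_assoc]
    ring_nf

namespace IsTL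

variable {k : ℕ} {u v w : F} {E : ℕ → A}

/-! ### The Jucys-Murphy recursion -/

lemma commute_murphy (h : IsTL k u v w E) {W : ℕ → A}
    (hW : ∀ j, 1 ≤ j → j < k → W (j + 1) = shift u (E j) * W j * shift u (E j))
    (h1 : ∀ i, 2 ≤ i → i < k → Commute (E i) (W 1)) :
    ∀ j i, 1 ≤ j → j < i → i < k → Commute (E i) (W j) := by
  intro j
  induction j with
  | zero => intro i h0; omega
  | succ j ih =>
    intro i _ hi hik
    rcases Nat.eq_zero_or_pos j with rfl | hj
    · exact h1 i hi hik
    · have c : Commute (E i) (E j) := (h.comm (by omega) (by omega)).symm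
      rw [hW j hj (by omega)]
      exact ((Commute.shift_right c _).mul_right (ih i hj (by omega) hik)).mul_right
        (Commute.shift_right c _)

/-- Each of the two sides of `W_{j+2} = T_{j+1} T_j W_j T_j T_{j+1}` loses its crossings to an arc
slide, whence `u²`; the remaining `E_{j+2} E_{j+1} E_{j+2}` is a zigzag. -/
lemma mul_murphy_add_two (h : IsTL k u v w E) {W : ℕ → A}
    (hW : ∀ j, 1 ≤ j → j < k → W (j + 1) = shift u (E j) * W j * shift u (E j))
    (h1 : ∀ i, 2 ≤ i → i < k → Commute (E i) (W 1)) {j : ℕ} (hj : 1 ≤ j) (hjk : j + 2 < k) :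
    E (j + 2) * W (j + 2) * (E j * E (j + 2)) = u ^ 2 • (E j * W j * (E j * E (j + 2))) := by
  have c1 := h.commute_murphy hW h1 j (j + 1) hj (by omega) (by omega)
  have c2 := h.commute_murphy hW h1 j (j + 2) hj (by omega) hjk
  have c3 : Commute (E j) (E (j + 2)) := h.comm (by omega) (by omega)
  have e1 := shift_shift_mul h.u_ne (h.sq hj (by omega)) (h.up hj (by omega))
  have e2 := shift_shift_mul h.u_ne (h.sq (i := j + 1) (by omega) (by omega))
    (h.down hj (by omega))
  have e3 := h.down (i := j + 1) (by omega) (by omega)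
  rw [hW (j + 1) (by omega) (by omega), hW j hj (by omega)]
  simp only [show j + 1 + 1 = j + 2 by ring] at *
  set a := E j
  set b := E (j + 1)
  set c := E (j + 2)
  generalize W j = X at *
  calc c * (shift u b * (shift u a * X * shift u a) * shift u b) * (a * c)
      = c * (shift u b * shift u a * X * (shift u a * shift u b * a) * c) := by
        simp only [mul_assoc]
    _ = u • (c * (shift u b * shift u a * (X * b) * a * c)) := by
        rw [e1]; simp only [mul_assoc, mul_smul_comm, smul_mul_assoc]
    _ = u • (c * ((shift u b * shift u a * b) * X * a * c)) := by
        rw [← c1.eq]; simp only [mul_assoc]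
    _ = u ^ 2 • ((c * a) * b * X * (a * c)) := by
        rw [e2]; simp only [mul_assoc, mul_smul_comm, smul_mul_assoc, smul_smul, pow_two]
    _ = u ^ 2 • (a * c * b * (X * c) * a) := by
        rw [c3.eq]; simp only [mul_assoc]
    _ = u ^ 2 • (a * (c * b * c) * X * a) := by
        rw [← c2.eq]; simp only [mul_assoc]
    _ = u ^ 2 • (a * X * (a * c)) := by
        rw [e3, mul_assoc a c X, c2.eq, c3.eq, ← mul_assoc a X c, mul_assoc (a * X) c a]

/-- As `T_j E_j = -u⁻¹ E_j`, one gets `W_{j+1} E_j = -u⁻¹ (E_j + u) W_j E_j`, whose second term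
cancels `W_j E_j`. -/
lemma murphy_add_murphy_mul (h : IsTL k u v w E) {W : ℕ → A}
    (hW : ∀ j, 1 ≤ j → j < k → W (j + 1) = shift u (E j) * W j * shift u (E j))
    {j : ℕ} (hj : 1 ≤ j) (hjk : j < k) :
    (W j + W (j + 1)) * E j = -u⁻¹ • (E j * W j * E j) := by
  rw [hW j hj hjk, add_mul, mul_assoc _ _ (E j), shift_mul_self (h.sq hj hjk)]
  have := h.u_ne
  simp only [shift, add_mul, mul_smul_comm, smul_mul_assoc, one_mul, mul_assoc]
  match_scalars <;> field_simp
  ring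

lemma stepProd_eq_mul (h : IsTL k u v w E) {m N n : ℕ} (hN : m + 2 * N ≤ k + 1) (hn : n < N) :
    ∃ r, stepProd E m N = E (m + 2 * n) * r := by
  obtain ⟨l, rfl⟩ : ∃ l, N = n + (l + 1) := ⟨N - n - 1, by omega⟩
  have c : Commute (E (m + 2 * n)) (stepProd E m n) :=
    commute_stepProd fun j hj => (h.comm (by omega) (by omega)).symm
  refine ⟨stepProd E m n * stepProd E (m + 2 * n + 2) l, ?_⟩
  rw [stepProd_add, stepProd_succ', ← mul_assoc, ← c.eq, mul_assoc]

lemma stepProd_eq_mul_mul (h : IsTL k u v w E) {m N n : ℕ} (hN : m + 2 * N ≤ k + 1)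
    (hn : n + 1 < N) :
    ∃ r, stepProd E m N = E (m + 2 * n) * E (m + 2 * n + 2) * r := by
  obtain ⟨l, rfl⟩ : ∃ l, N = n + (l + 1 + 1) := ⟨N - n - 2, by omega⟩
  have c : Commute (E (m + 2 * n)) (stepProd E m n) :=
    commute_stepProd fun j hj => (h.comm (by omega) (by omega)).symm
  have c' : Commute (E (m + 2 * n + 2)) (stepProd E m n) :=
    commute_stepProd fun j hj => (h.comm (by omega) (by omega)).symm
  refine ⟨stepProd E m n * stepProd E (m + 2 * n + 2 + 2) l, ?_⟩
  rw [stepProd_add, stepProd_succ', stepProd_succ', ← mul_assoc (E (m + 2 * n)), ← mul_assoc,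
    ← (c.mul_left c').eq, mul_assoc]

lemma mul_murphy_mul_stepProd (h : IsTL k u v w E) {W : ℕ → A}
    (hW : ∀ j, 1 ≤ j → j < k → W (j + 1) = shift u (E j) * W j * shift u (E j))
    (h1 : ∀ i, 2 ≤ i → i < k → Commute (E i) (W 1)) {m N : ℕ} (hm : 1 ≤ m)
    (hN : m + 2 * N ≤ k + 1) (n : ℕ) (hn : n < N) :
    E (m + 2 * n) * W (m + 2 * n) * stepProd E m N = u ^ (2 * n) • (E m * W m * stepProd E m N) := by
  induction n with
  | zero => simp
  | succ n ih =>
    have ih' := ih (by omega)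
    obtain ⟨r, hr⟩ := h.stepProd_eq_mul_mul hN hn
    have := h.mul_murphy_add_two hW h1 (j := m + 2 * n) (by omega) (by omega)
    rw [show m + 2 * (n + 1) = m + 2 * n + 2 by ring, show 2 * (n + 1) = 2 + 2 * n by ring, pow_add,
      mul_smul, ← ih', hr, ← mul_assoc, this, smul_mul_assoc]
    simp only [mul_assoc]

lemma murphy_add_murphy_mul_stepProd (h : IsTL k u v w E) {W : ℕ → A}
    (hW : ∀ j, 1 ≤ j → j < k → W (j + 1) = shift u (E j) * W j * shift u (E j))
    (h1 : ∀ i, 2 ≤ i → i < k → Commute (E i) (W 1)) {m N : ℕ} (hm : 1 ≤ m)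
    (hN : m + 2 * N ≤ k + 1) (n : ℕ) (hn : n < N) :
    (W (m + 2 * n) + W (m + 2 * n + 1)) * stepProd E m N =
      (-u⁻¹ * u ^ (2 * n)) • (E m * W m * stepProd E m N) := by
  obtain ⟨r, hr⟩ := h.stepProd_eq_mul hN hn
  rw [mul_smul, ← h.mul_murphy_mul_stepProd hW h1 hm hN n hn, hr, ← mul_assoc,
    h.murphy_add_murphy_mul hW (by omega) (by omega), smul_mul_assoc, mul_assoc _ _ r]

/-! ### Even rank -/

/-- Of the four terms of the expansion, those keeping one boundary generator cascade to a boundary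
relation, and the one keeping neither is a closed loop. General `x`, `y` allow both `(v⁻¹, w)` and
`(v, w⁻¹)`, where the coefficient has the same value. -/
lemma even_sandwich (h : IsTL k u v w E) {n : ℕ} (hk : k = 2 * n + 2) (x y : F) :
    stepProd E 1 (n + 1) * (shift x (E 0) * stepProd E 2 n * shift y (E k)) *
        stepProd E 1 (n + 1) =
      stepProd E 1 (n + 1) * (E 0 * stepProd E 2 n * E k) * stepProd E 1 (n + 1) +
        (y * (v * u⁻¹ + u * v⁻¹) + x * (w * u⁻¹ + u * w⁻¹) - x * y * (u + u⁻¹)) •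
          stepProd E 1 (n + 1) := by
  have r1 := h.stepProd_cascade_left (E k) n 1 le_rfl (by omega) fun j hj =>
    (h.comm (by omega) le_rfl).symm
  have r2 := h.stepProd_cascade_right (E 0) 1 n le_rfl (by omega) fun j hj =>
    h.comm (by omega) (by omega)
  have r3 := h.stepProd_loop 1 n le_rfl (by omega)
  have hr := h.right
  rw [show k - 1 = 1 + 2 * n by omega] at hr
  rw [hr, mul_smul_comm, ← stepProd_succ] at r1
  rw [h.left, smul_mul_assoc, ← stepProd_succ' E 1 n] at r2
  simp only [show 1 + 1 = 2 from rfl] at *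
  generalize stepProd E 1 (n + 1) = P at *
  generalize stepProd E 2 n = Q at *
  simp only [shift, add_mul, mul_add, smul_mul_assoc, mul_smul_comm, one_mul, mul_one]
  simp only [← mul_assoc] at *
  rw [r1, r2, r3]
  module

/-- The factor `-u²` is `-u` from `E_1 T_1⁻¹` times `u` from pulling the arc of `E_1` round the left
pole, which turns `T_0` into its inverse. -/
lemma mul_murphyOne_mul_of_even (h : IsTL k u v w E) {n : ℕ} (hk : k = 2 * n + 2) :
    E 1 * (conjIter u E (shift w (E k)) 1 (2 * n + 1) * shift v (E 0)) * stepProd E 1 (n + 1) =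
      -u ^ 2 • (stepProd E 1 (n + 1) * (shift v⁻¹ (E 0) * stepProd E 2 n * shift w (E k)) *
        stepProd E 1 (n + 1)) := by
  have key := h.conjIter_mul_stepProd (shift w (E k))
    (fun i hi => Commute.shift_left (h.comm hi le_rfl).symm w) n 2 (by omega) (by omega)
  have e1 := self_mul_shift (h.bar.sq le_rfl (by omega))
  have e2 := shift_shift_mul_pole h.u_ne h.v_ne (h.sq le_rfl (by omega)) h.left
  have c1 : Commute (shift v⁻¹ (E 0)) (stepProd E 3 n) :=
    Commute.shift_left (commute_stepProd fun j hj => h.comm (by omega) (by omega)) _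
  have c2 : Commute (shift v⁻¹ (E 0)) (stepProd E 2 n) :=
    Commute.shift_left (commute_stepProd fun j hj => h.comm (by omega) (by omega)) _
  have c3 : Commute (shift v⁻¹ (E 0)) (shift w (E k)) :=
    Commute.shift_left (Commute.shift_right (h.comm (by omega) le_rfl) _) _
  have c4 : Commute (E 1) (stepProd E 3 n) :=
    commute_stepProd fun j hj => h.comm (by omega) (by omega)
  rw [stepProd_succ', conjIter]
  simp only [show 1 + 1 = 2 from rfl, show 1 + 2 = 3 from rfl,
    inv_inv] at *
  generalize stepProd E 3 n = P at *
  generalize stepProd E 2 n = Q at *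
  generalize conjIter u E _ 2 (2 * n) = C at *
  generalize shift w (E k) = Y at *
  set b := E 1
  calc b * (shift u⁻¹ b * C * shift u b * shift v (E 0)) * (b * P)
      = (b * shift u⁻¹ b) * C * (shift u b * shift v (E 0) * b) * P := by simp only [mul_assoc]
    _ = -u ^ 2 • (b * C * (shift v⁻¹ (E 0) * (b * P))) := by
      rw [e1, e2]
      simp only [mul_assoc, mul_smul_comm, smul_mul_assoc]
      module
    _ = -u ^ 2 • (b * (C * P) * (shift v⁻¹ (E 0) * b)) := by
      rw [c4.eq, ← mul_assoc _ P b, c1.eq]; simp only [mul_assoc]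
    _ = -u ^ 2 • (b * P * (Q * Y * shift v⁻¹ (E 0)) * (P * b)) := by
      rw [key, mul_assoc _ _ (P * b), mul_assoc _ _ (P * b), ← mul_assoc _ P b, c1.eq]
      simp only [mul_assoc]
    _ = _ := by
      rw [← (c2.mul_right c3).eq, ← c4.eq]; simp only [mul_assoc]

lemma mul_murphyOne_inv_mul_of_even (h : IsTL k u v w E) {n : ℕ} (hk : k = 2 * n + 2) :
    E 1 * (shift v⁻¹ (E 0) * conjIter u E (shift w⁻¹ (E k)) 1 (2 * n + 1)) *
        stepProd E 1 (n + 1) =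
      -(u ^ 2)⁻¹ • (stepProd E 1 (n + 1) * (shift v (E 0) * stepProd E 2 n * shift w⁻¹ (E k)) *
        stepProd E 1 (n + 1)) := by
  have key := h.conjIter_mul_stepProd (shift w⁻¹ (E k))
    (fun i hi => Commute.shift_left (h.comm hi le_rfl).symm w⁻¹) n 2 (by omega) (by omega)
  have e1 := shift_mul_self (h.sq le_rfl (by omega))
  have e2 := mul_shift_shift_pole h.bar.u_ne h.bar.v_ne (h.bar.sq le_rfl (by omega)) h.bar.left
  have c1 : Commute (shift v (E 0)) (stepProd E 3 n) :=
    Commute.shift_left (commute_stepProd fun j hj => h.comm (by omega) (by omega)) _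
  have c4 : Commute (E 1) (stepProd E 3 n) :=
    commute_stepProd fun j hj => h.comm (by omega) (by omega)
  rw [stepProd_succ', conjIter]
  simp only [show 1 + 1 = 2 from rfl, show 1 + 2 = 3 from rfl,
    inv_inv] at *
  generalize stepProd E 3 n = P at *
  generalize stepProd E 2 n = Q at *
  generalize conjIter u E _ 2 (2 * n) = C at *
  generalize shift w⁻¹ (E k) = Y at *
  set b := E 1
  calc b * (shift v⁻¹ (E 0) * (shift u⁻¹ b * C * shift u b)) * (b * P)
      = (b * shift v⁻¹ (E 0) * shift u⁻¹ b) * C * (shift u b * b) * P := by simp only [mul_assoc]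
    _ = -(u ^ 2)⁻¹ • (b * shift v (E 0) * C * (b * P)) := by
      rw [e1, e2]
      simp only [mul_assoc, mul_smul_comm, smul_mul_assoc]
      module
    _ = -(u ^ 2)⁻¹ • (b * (shift v (E 0) * P) * Q * Y * (P * b)) := by
      rw [c4.eq, mul_assoc _ C, ← mul_assoc C, key]; simp only [mul_assoc]
    _ = _ := by
      rw [c1.eq, ← c4.eq]; simp only [mul_assoc]

/-! ### Odd rank -/

/-- Moving the arc of `E_2` past the left pole reverses the loop `T_1 T_0 T_1`. The three factors
`u` come from `f1`, `e3` and `f2`. -/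
lemma braid_pole (h : IsTL k u v w E) (hk : 3 ≤ k) :
    shift u (E 2) * shift u (E 1) * shift v (E 0) * shift u (E 1) * E 2 =
      u ^ 3 • (shift u⁻¹ (E 1) * shift v⁻¹ (E 0) * shift u⁻¹ (E 1) * E 2) := by
  have s1 := h.sq (i := 1) le_rfl (by omega)
  have s2 := h.sq (i := 2) (by omega) (by omega)
  have c : Commute (shift v (E 0)) (shift u⁻¹ (E 2)) :=
    Commute.shift_left (Commute.shift_right (h.comm (by omega) (by omega)) _) _
  have c' : Commute (shift u (E 2)) (shift v⁻¹ (E 0)) :=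
    Commute.shift_left (Commute.shift_right (h.comm (by omega) (by omega)).symm _) _
  have i1 := shift_inv_mul_shift h.u_ne s1
  have i2 := shift_inv_mul_shift h.u_ne s2
  have i2' := shift_mul_shift_inv h.u_ne s2
  have b := shift_braid h.u_ne s1 s2 (h.up le_rfl hk) (h.down le_rfl hk)
  have e1 := shift_shift_mul h.u_ne s2 (h.down le_rfl hk)
  have e2 := shift_shift_mul h.bar.u_ne (h.bar.sq (i := 2) (by omega) (by omega))
    (h.down le_rfl hk)
  have e3 := shift_shift_mul_pole h.u_ne h.v_ne s1 h.left
  set x := E 1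
  set y := E 2
  have f1 : shift u x * y = u • (shift u⁻¹ y * (x * y)) := by
    rw [← mul_smul_comm, ← e1, ← mul_assoc, ← mul_assoc, i2, one_mul]
  have f2 : shift u y * (x * y) = u • (shift u⁻¹ x * y) := by
    have : x * y = u • (shift u⁻¹ y * shift u⁻¹ x * y) := by
      rw [e2, smul_smul, mul_inv_cancel₀ h.u_ne, one_smul]
    rw [this, mul_smul_comm, ← mul_assoc, ← mul_assoc, i2', one_mul]
  have f3 : shift u y * shift u x * shift u⁻¹ y = shift u⁻¹ x * shift u y * shift u x := by
    calc shift u y * shift u x * shift u⁻¹ y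
        = shift u⁻¹ x * (shift u x * shift u y * shift u x) * shift u⁻¹ y := by
          rw [← mul_assoc, ← mul_assoc, i1, one_mul]
      _ = shift u⁻¹ x * shift u y * shift u x := by
          rw [b, mul_assoc, mul_assoc, i2', mul_one, mul_assoc]
  calc shift u y * shift u x * shift v (E 0) * shift u x * y
      = shift u y * shift u x * shift v (E 0) * (shift u x * y) := by simp only [mul_assoc]
    _ = u • (shift u y * shift u x * (shift v (E 0) * shift u⁻¹ y) * (x * y)) := by
        rw [f1, mul_smul_comm]; simp only [mul_assoc]
    _ = u • ((shift u y * shift u x * shift u⁻¹ y) * shift v (E 0) * (x * y)) := by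
        rw [c.eq]; simp only [mul_assoc]
    _ = u • (shift u⁻¹ x * shift u y * (shift u x * shift v (E 0) * x) * y) := by
        rw [f3]; simp only [mul_assoc]
    _ = u ^ 2 • (shift u⁻¹ x * (shift u y * shift v⁻¹ (E 0)) * (x * y)) := by
        rw [e3]; simp only [mul_assoc, mul_smul_comm, smul_mul_assoc, smul_smul, pow_two]
    _ = u ^ 2 • (shift u⁻¹ x * shift v⁻¹ (E 0) * (shift u y * (x * y))) := by
        rw [c'.eq]; simp only [mul_assoc]
    _ = _ := by
        rw [f2]; simp only [mul_assoc, mul_smul_comm, smul_smul, pow_succ, pow_zero, one_mul]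

/-- `braid_pole` with all words reversed, as required for the inverse Murphy element, where the pole
loop stands to the left of the conjugate. -/
lemma pole_braid (h : IsTL k u v w E) (hk : 3 ≤ k) :
    E 2 * shift u (E 1) * shift v (E 0) * shift u (E 1) * shift u (E 2) =
      u ^ 3 • (E 2 * shift u⁻¹ (E 1) * shift v⁻¹ (E 0) * shift u⁻¹ (E 1)) := by
  have s1 := h.sq (i := 1) le_rfl (by omega)
  have s2 := h.sq (i := 2) (by omega) (by omega)
  have c : Commute (shift v (E 0)) (shift u⁻¹ (E 2)) :=
    Commute.shift_left (Commute.shift_right (h.comm (by omega) (by omega)) _) _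
  have c' : Commute (shift u (E 2)) (shift v⁻¹ (E 0)) :=
    Commute.shift_left (Commute.shift_right (h.comm (by omega) (by omega)).symm _) _
  have i1 := shift_mul_shift_inv h.u_ne s1
  have i2 := shift_inv_mul_shift h.u_ne s2
  have i2' := shift_mul_shift_inv h.u_ne s2
  have b := shift_braid h.u_ne s1 s2 (h.up le_rfl hk) (h.down le_rfl hk)
  have e1 := mul_shift_shift h.u_ne s2 (h.down le_rfl hk)
  have e2 := mul_shift_shift h.bar.u_ne (h.bar.sq (i := 2) (by omega) (by omega))
    (h.down le_rfl hk)
  have e3 := mul_shift_shift_pole h.u_ne h.v_ne s1 h.left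
  set x := E 1
  set y := E 2
  have f1 : y * shift u x = u • (y * x * shift u⁻¹ y) := by
    rw [← smul_mul_assoc, ← e1, mul_assoc, i2', mul_one]
  have f2 : y * x * shift u y = u • (y * shift u⁻¹ x) := by
    have : y * x = u • (y * shift u⁻¹ x * shift u⁻¹ y) := by
      rw [e2, smul_smul, mul_inv_cancel₀ h.u_ne, one_smul]
    rw [this, smul_mul_assoc, mul_assoc, i2, mul_one]
  have f3 : shift u⁻¹ y * shift u x * shift u y = shift u x * shift u y * shift u⁻¹ x := by
    calc shift u⁻¹ y * shift u x * shift u y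
        = shift u⁻¹ y * (shift u x * shift u y * shift u x) * shift u⁻¹ x := by
          simp only [mul_assoc]; rw [i1, mul_one]
      _ = shift u x * shift u y * shift u⁻¹ x := by
          rw [b, ← mul_assoc, ← mul_assoc, i2, one_mul]
  calc y * shift u x * shift v (E 0) * shift u x * shift u y
      = u • (y * x * (shift v (E 0) * shift u⁻¹ y) * shift u x * shift u y) := by
        rw [f1, c.eq]; simp only [mul_assoc, smul_mul_assoc]
    _ = u • (y * x * shift v (E 0) * (shift u⁻¹ y * shift u x * shift u y)) := by
        simp only [mul_assoc]
    _ = u • (y * (x * shift v (E 0) * shift u x) * shift u y * shift u⁻¹ x) := by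
        rw [f3]; simp only [mul_assoc]
    _ = u ^ 2 • (y * x * (shift v⁻¹ (E 0) * shift u y) * shift u⁻¹ x) := by
        rw [e3]; simp only [mul_assoc, mul_smul_comm, smul_mul_assoc, smul_smul, pow_two]
    _ = u ^ 2 • ((y * x * shift u y) * shift v⁻¹ (E 0) * shift u⁻¹ x) := by
        rw [← c'.eq]; simp only [mul_assoc]
    _ = _ := by
        rw [f2]; simp only [mul_assoc, smul_mul_assoc, smul_smul, pow_succ, pow_zero, one_mul]

end IsTL
end Abstract
end TwoBoundary

namespace TwoBoundary

section Abstract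

variable {F A : Type*} [Field F] [Ring A] [Algebra F A]

namespace IsTL

variable {k : ℕ} {u v w : F} {E : ℕ → A}

/-- The left outer factor omits `E_0`: the right-hand `E_0` alone supplies both copies in the
answer. Restoring it later costs `-(v + v⁻¹)`, the origin of the factor `⟦t_0⟧` in the theorem. -/
lemma odd_sandwich (h : IsTL k u v w E) {n : ℕ} (hk : k = 2 * n + 3) :
    stepProd E 2 (n + 1) * (shift u⁻¹ (E 1) * shift v⁻¹ (E 0) * shift u⁻¹ (E 1) *
        stepProd E 3 n * shift w (E k)) * (stepProd E 2 (n + 1) * E 0) =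
      u⁻¹ • ((stepProd E 2 (n + 1) * E 0) * (stepProd E 1 (n + 1) * E k) *
        (stepProd E 2 (n + 1) * E 0) -
          (v * w⁻¹ + w * v⁻¹) • (stepProd E 2 (n + 1) * E 0)) := by
  have hu := h.u_ne
  have hv := h.v_ne
  have hw := h.w_ne
  have cJ : Commute (E 0) (stepProd E 2 (n + 1)) :=
    commute_stepProd fun j hj => h.comm (by omega) (by omega)
  have cO : Commute (E 0) (stepProd E 3 n) :=
    commute_stepProd fun j hj => h.comm (by omega) (by omega)
  have c2 : Commute (E 0) (E 2) := h.comm (by omega) (by omega)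
  have ck : Commute (E 0) (E k) := h.comm (by omega) le_rfl
  -- The multiples of `E_1 E_0` cancel, so the result begins with `E_0`.
  have t : shift u⁻¹ (E 1) * shift v⁻¹ (E 0) * shift u⁻¹ (E 1) * E 0 =
      u⁻¹ • (E 0 * E 1 * E 0) - (u⁻¹ * u⁻¹ * v) • E 0 := by
    have e1 : E 1 * shift v⁻¹ (E 0) * shift u⁻¹ (E 1) = u⁻¹ • (E 1 * shift v (E 0)) := by
      have := mul_shift_shift_pole h.bar.u_ne h.bar.v_ne (h.bar.sq le_rfl (by omega)) h.bar.left
      rwa [inv_inv] at this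
    have e2 : shift u⁻¹ (E 1) * shift v⁻¹ (E 0) * shift u⁻¹ (E 1) =
        u⁻¹ • (E 1 * shift v (E 0)) + u⁻¹ • (shift v⁻¹ (E 0) * shift u⁻¹ (E 1)) := by
      rw [← e1]
      change (E 1 + u⁻¹ • 1) * _ * _ = _
      rw [add_mul, add_mul, smul_mul_assoc, one_mul, smul_mul_assoc]
    rw [e2]
    simp only [shift, add_mul, mul_add, smul_mul_assoc, mul_smul_comm, one_mul, mul_one,
      h.sq_zero, mul_assoc]
    module
  have r1 : stepProd E 2 (n + 1) * (E 0 * E 1 * E 0 * stepProd E 3 n) * stepProd E 2 (n + 1) =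
      -(v + v⁻¹) • (stepProd E 2 (n + 1) * E 0) := by
    rw [h.stepProd_cascade_right (E 0 * E 1 * E 0) 2 n (by omega) (by omega) fun j hj =>
      ((h.comm (by omega) (by omega) : Commute (E 0) _).mul_left
        (h.comm (by omega) (by omega))).mul_left (h.comm (by omega) (by omega)), ← cJ.eq,
      stepProd_succ' E 2 n]
    have hd := h.down (i := 1) le_rfl (by omega)
    calc E 2 * (E 0 * E 1 * E 0) * E 2 * stepProd E (2 + 2) n
        = (E 2 * E 0) * E 1 * (E 0 * E 2) * stepProd E (2 + 2) n := by simp only [mul_assoc]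
      _ = E 0 * (E 2 * E 1 * E 2) * E 0 * stepProd E (2 + 2) n := by
        rw [← c2.eq, c2.eq]; nth_rw 1 [← c2.eq]; simp only [mul_assoc]
      _ = (E 0 * E 0) * (E 2 * stepProd E (2 + 2) n) := by
        rw [hd, mul_assoc (E 0), ← c2.eq]; simp only [mul_assoc]
      _ = _ := by rw [h.sq_zero, smul_mul_assoc]
  have r2 : stepProd E 2 (n + 1) * stepProd E 3 n * E k * stepProd E 2 (n + 1) =
      (w * u⁻¹ + u * w⁻¹) • stepProd E 2 (n + 1) := by
    have hr := h.right
    rw [show k - 1 = 2 + 2 * n by omega] at hr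
    rw [h.stepProd_cascade_left (E k) n 2 (by omega) (by omega) fun j hj =>
      (h.comm (by omega) le_rfl).symm, hr, mul_smul_comm, ← stepProd_succ]
  have r3 := h.stepProd_loop 2 n (by omega) (by omega)
  have hO : stepProd E 1 (n + 1) = E 1 * stepProd E 3 n := stepProd_succ' E 1 n
  rw [hO]
  simp only [show 2 + 1 = 3 from rfl] at r3
  generalize stepProd E 2 (n + 1) = J at *
  generalize stepProd E 3 n = O at *
  generalize shift u⁻¹ (E 1) * shift v⁻¹ (E 0) * shift u⁻¹ (E 1) = X at *
  -- `E_0` commutes with everything between it and `X`, so it can be moved next to `X` for `t` to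
  -- apply.
  have step : J * (X * O * shift w (E k)) * (J * E 0) =
      J * (X * E 0) * O * shift w (E k) * J := by
    have ck' : Commute (E 0) (shift w (E k)) := Commute.shift_right ck _
    rw [← cJ.eq, ← mul_assoc, mul_assoc J _ (E 0), mul_assoc _ _ (E 0), ← ck'.eq]
    simp only [← mul_assoc]
    rw [mul_assoc (J * X) O (E 0), ← cO.eq]
    simp only [← mul_assoc]
  have r1' : J * E 0 * E 1 * E 0 * O * J = -(v + v⁻¹) • (J * E 0) := by
    rw [← r1]; simp only [mul_assoc]
  have r4 : J * E 0 * E 1 * E 0 * O * E k * J = J * E 0 * E 1 * O * E k * J * E 0 := by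
    calc J * E 0 * E 1 * E 0 * O * E k * J
        = J * E 0 * E 1 * (E 0 * (O * E k * J)) := by simp only [mul_assoc]
      _ = _ := by rw [((cO.mul_right ck).mul_right cJ).eq]; simp only [mul_assoc]
  have r5 : J * E 0 * O * E k * J = (w * u⁻¹ + u * w⁻¹) • (J * E 0) := by
    calc J * E 0 * O * E k * J = J * (E 0 * (O * E k * J)) := by simp only [mul_assoc]
      _ = J * O * E k * J * E 0 := by
        rw [((cO.mul_right ck).mul_right cJ).eq]; simp only [mul_assoc]
      _ = _ := by rw [r2, smul_mul_assoc]
  have r6 : J * E 0 * O * J = -(u + u⁻¹) • (J * E 0) := by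
    calc J * E 0 * O * J = J * (E 0 * (O * J)) := by simp only [mul_assoc]
      _ = J * O * J * E 0 := by
        rw [(cO.mul_right cJ).eq]; simp only [mul_assoc]
      _ = _ := by rw [r3, smul_mul_assoc]
  rw [step, t]
  simp only [shift, mul_sub, sub_mul, mul_add, add_mul, smul_mul_assoc, mul_smul_comm, mul_one,
    ← mul_assoc, r1', r4, r5, r6]
  match_scalars <;> (field_simp; try ring)


lemma commute_pole {x : A} (h0 : Commute (E 0) x) (h1 : Commute (E 1) x)
    (y z : F) : Commute (shift y (E 1) * shift z (E 0) * shift y (E 1)) x :=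
  ((Commute.shift_left h1 _).mul_left (Commute.shift_left h0 _)).mul_left (Commute.shift_left h1 _)

/-- In `W_2 = T_1 W_1 T_1` the leading `T_1 T_1⁻¹` cancels, leaving a conjugate starting at index 2
followed by the pole loop of `braid_pole`. The constant is `-u` from `E_2 T_2⁻¹` times `u³`. -/
lemma mul_murphyTwo_mul_of_odd (h : IsTL k u v w E) {n : ℕ} (hk : k = 2 * n + 3) :
    E 2 * (shift u (E 1) * (conjIter u E (shift w (E k)) 1 (2 * n + 2) * shift v (E 0)) *
        shift u (E 1)) * (stepProd E 2 (n + 1) * E 0) =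
      -u ^ 4 • (stepProd E 2 (n + 1) * (shift u⁻¹ (E 1) * shift v⁻¹ (E 0) * shift u⁻¹ (E 1) *
        stepProd E 3 n * shift w (E k)) * (stepProd E 2 (n + 1) * E 0)) := by
  have key := h.conjIter_mul_stepProd (shift w (E k))
    (fun i hi => Commute.shift_left (h.comm hi le_rfl).symm w) n 3 (by omega) (by omega)
  have s1 := shift_mul_shift_inv h.u_ne (h.sq (i := 1) le_rfl (by omega))
  have e1 := self_mul_shift (h.bar.sq (i := 2) (by omega) (by omega))
  have e2 := h.braid_pole (by omega)
  have c1 := commute_pole (x := stepProd E 4 n)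
    (commute_stepProd fun j hj => h.comm (by omega) (by omega))
    (commute_stepProd fun j hj => h.comm (by omega) (by omega)) u⁻¹ v⁻¹
  have c2 := commute_pole (x := stepProd E 3 n * shift w (E k))
    ((commute_stepProd fun j hj => h.comm (by omega) (by omega)).mul_right
      (Commute.shift_right (h.comm (by omega) le_rfl) _))
    ((commute_stepProd fun j hj => h.comm (by omega) (by omega)).mul_right
      (Commute.shift_right (h.comm (by omega) le_rfl) _)) u⁻¹ v⁻¹
  have c3 : Commute (E 2) (stepProd E 4 n) :=
    commute_stepProd fun j hj => h.comm (by omega) (by omega)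
  rw [stepProd_succ', conjIter, conjIter]
  simp only [show 1 + 1 = 2 from rfl, show 2 + 1 = 3 from rfl, show 2 + 2 = 4 from rfl, inv_inv] at *
  generalize stepProd E 4 n = P at *
  generalize stepProd E 3 n = Q at *
  generalize conjIter u E _ 3 (2 * n) = C at *
  generalize shift w (E k) = Y at *
  have e2' : shift u (E 2) * shift u (E 1) * shift v (E 0) * shift u (E 1) * E 2 =
      u ^ 3 • ((shift u⁻¹ (E 1) * shift v⁻¹ (E 0) * shift u⁻¹ (E 1)) * E 2) := e2
  generalize shift u⁻¹ (E 1) * shift v⁻¹ (E 0) * shift u⁻¹ (E 1) = X at *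
  set a := E 1
  set b := E 2
  set z := E 0
  calc b * (shift u a * (shift u⁻¹ a * (shift u⁻¹ b * C * shift u b) * shift u a * shift v z) *
          shift u a) * (b * P * z)
      = b * ((shift u a * shift u⁻¹ a) * (shift u⁻¹ b * C * shift u b) * shift u a * shift v z *
          shift u a) * (b * P * z) := by simp only [mul_assoc]
    _ = (b * shift u⁻¹ b) * C * (shift u b * shift u a * shift v z * shift u a * b) * P * z := by
      rw [s1, one_mul]; simp only [mul_assoc]
    _ = -u ^ 4 • (b * C * (X * (b * P)) * z) := by
      rw [e1, e2']
      simp only [mul_assoc, mul_smul_comm, smul_mul_assoc]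
      module
    _ = -u ^ 4 • (b * (C * P) * (X * b) * z) := by
      rw [c3.eq, ← mul_assoc X, c1.eq]; simp only [mul_assoc]
    _ = -u ^ 4 • (b * P * (Q * Y) * (P * X) * b * z) := by
      rw [key]; simp only [mul_assoc]
    _ = -u ^ 4 • (b * P * (Q * Y * X) * (P * b) * z) := by
      rw [← c1.eq]; simp only [mul_assoc]
    _ = _ := by
      rw [← c2.eq, ← c3.eq]; simp only [mul_assoc]

lemma mul_murphyTwo_inv_mul_of_odd (h : IsTL k u v w E) {n : ℕ} (hk : k = 2 * n + 3) :
    E 2 * (shift u⁻¹ (E 1) * (shift v⁻¹ (E 0) * conjIter u E (shift w⁻¹ (E k)) 1 (2 * n + 2)) *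
        shift u⁻¹ (E 1)) * (stepProd E 2 (n + 1) * E 0) =
      -(u ^ 4)⁻¹ • (stepProd E 2 (n + 1) * (shift u (E 1) * shift v (E 0) * shift u (E 1) *
        stepProd E 3 n * shift w⁻¹ (E k)) * (stepProd E 2 (n + 1) * E 0)) := by
  have key := h.conjIter_mul_stepProd (shift w⁻¹ (E k))
    (fun i hi => Commute.shift_left (h.comm hi le_rfl).symm w⁻¹) n 3 (by omega) (by omega)
  have s1 := shift_mul_shift_inv h.u_ne (h.sq (i := 1) le_rfl (by omega))
  have e1 := shift_mul_self (h.sq (i := 2) (by omega) (by omega))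
  have e2 := h.bar.pole_braid (by omega)
  have c1 := commute_pole (x := stepProd E 4 n)
    (commute_stepProd fun j hj => h.comm (by omega) (by omega))
    (commute_stepProd fun j hj => h.comm (by omega) (by omega)) u v
  have c3 : Commute (E 2) (stepProd E 4 n) :=
    commute_stepProd fun j hj => h.comm (by omega) (by omega)
  rw [stepProd_succ', conjIter, conjIter]
  simp only [show 1 + 1 = 2 from rfl, show 2 + 1 = 3 from rfl, show 2 + 2 = 4 from rfl, inv_inv] at *
  generalize stepProd E 4 n = P at *
  generalize stepProd E 3 n = Q at *
  generalize conjIter u E _ 3 (2 * n) = C at *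
  generalize shift w⁻¹ (E k) = Y at *
  have e2' : E 2 * shift u⁻¹ (E 1) * shift v⁻¹ (E 0) * shift u⁻¹ (E 1) * shift u⁻¹ (E 2) =
      u⁻¹ ^ 3 • (E 2 * (shift u (E 1) * shift v (E 0) * shift u (E 1))) := by
    rw [e2]; simp only [mul_assoc]
  generalize shift u (E 1) * shift v (E 0) * shift u (E 1) = X at *
  set a := E 1
  set b := E 2
  set z := E 0
  calc b * (shift u⁻¹ a * (shift v⁻¹ z * (shift u⁻¹ a * (shift u⁻¹ b * C * shift u b) *
          shift u a)) * shift u⁻¹ a) * (b * P * z)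
      = b * (shift u⁻¹ a * shift v⁻¹ z * shift u⁻¹ a * (shift u⁻¹ b * C * shift u b) *
          (shift u a * shift u⁻¹ a)) * (b * P * z) := by simp only [mul_assoc]
    _ = (b * shift u⁻¹ a * shift v⁻¹ z * shift u⁻¹ a * shift u⁻¹ b) * C * (shift u b * b) *
          P * z := by
      rw [s1, mul_one]; simp only [mul_assoc]
    _ = -(u ^ 4)⁻¹ • (b * X * C * (b * P) * z) := by
      rw [e1, e2']
      simp only [mul_assoc, mul_smul_comm, smul_mul_assoc]
      module
    _ = -(u ^ 4)⁻¹ • (b * X * (C * P) * b * z) := by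
      rw [c3.eq]; simp only [mul_assoc]
    _ = -(u ^ 4)⁻¹ • (b * (X * P) * Q * Y * (P * b) * z) := by
      rw [key]; simp only [mul_assoc]
    _ = _ := by
      rw [c1.eq, ← c3.eq]; simp only [mul_assoc]

lemma conjIter_shift (h : IsTL k u v w E) (x : F) (Y : A) (n : ℕ) : ∀ m, 1 ≤ m → m + n ≤ k →
    conjIter u E (shift x Y) m n = shift x (conjIter u E Y m n) := by
  induction n with
  | zero => intro m _ _; rfl
  | succ n ih =>
    intro m hm hk
    have hc (C : A) : shift u⁻¹ (E m) * shift x C * shift u (E m) =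
        shift x (shift u⁻¹ (E m) * C * shift u (E m)) := by
      change _ * (C + x • 1) * _ = _ * C * _ + x • 1
      rw [mul_add, add_mul, mul_smul_comm, smul_mul_assoc, mul_one,
        shift_inv_mul_shift h.u_ne (h.sq hm (by omega))]
    rw [conjIter, conjIter, ih (m + 1) (by omega) (by omega), hc]

lemma murphyOne_add_inv_mul_of_odd (h : IsTL k u v w E) {n : ℕ} (hk : k = 2 * n + 3) :
    (conjIter u E (shift w (E k)) 1 (2 * n + 2) * shift v (E 0) +
        shift v⁻¹ (E 0) * conjIter u E (shift w⁻¹ (E k)) 1 (2 * n + 2)) *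
        (stepProd E 2 (n + 1) * E 0) =
      (stepProd E 2 (n + 1) * E 0) * (stepProd E 1 (n + 1) * E k) *
        (stepProd E 2 (n + 1) * E 0) -
          (v * w⁻¹ + w * v⁻¹) • (stepProd E 2 (n + 1) * E 0) := by
  have key := h.conjIter_mul_stepProd (E k)
    (fun i hi => (h.comm hi le_rfl).symm) (n + 1) 1 le_rfl (by omega)
  have cJ : Commute (E 0) (stepProd E 2 (n + 1)) :=
    commute_stepProd fun j hj => h.comm (by omega) (by omega)
  have hv := h.v_ne
  have hw := h.w_ne
  rw [h.conjIter_shift _ _ _ _ le_rfl (by omega), h.conjIter_shift _ _ _ _ le_rfl (by omega)]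
  simp only [show 1 + 1 = 2 from rfl, show 2 * (n + 1) = 2 * n + 2 by ring] at *
  generalize conjIter u E (E k) 1 (2 * n + 2) = C at *
  generalize stepProd E 2 (n + 1) = J at *
  generalize stepProd E 1 (n + 1) = O at *
  -- `T_0 E_0 = -v⁻¹ E_0` makes the multiples of `C E_0` from the two summands cancel.
  have e1 : (shift w C * shift v (E 0) + shift v⁻¹ (E 0) * shift w⁻¹ C) * E 0 =
      E 0 * C * E 0 - (v * w⁻¹ + w * v⁻¹) • E 0 := by
    simp only [shift, add_mul, mul_add, smul_mul_assoc, mul_smul_comm, one_mul, mul_one, mul_assoc,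
      h.sq_zero]
    module
  rw [← cJ.eq, ← mul_assoc, e1, sub_mul, smul_mul_assoc, mul_assoc _ _ J, cJ.eq]
  congr 1
  calc E 0 * C * (J * E 0) = E 0 * (C * J) * E 0 := by simp only [mul_assoc]
    _ = (E 0 * J) * O * E k * J * E 0 := by rw [key]; simp only [mul_assoc]
    _ = _ := by rw [cJ.eq]; simp only [mul_assoc]

/-! ### The action of the central element -/

lemma commute_murphyOne (h : IsTL k u v w E) {i : ℕ} (hi : 2 ≤ i) (hik : i < k) :
    Commute (E i) (conjIter u E (shift w (E k)) 1 (k - 1) * shift v (E 0)) :=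
  (h.commute_conjIter_of_lt _ (fun _ hi => Commute.shift_left (h.comm hi le_rfl).symm w) _ _ _
    le_rfl (by omega) hi hik).mul_right
      (Commute.shift_right (h.comm (by omega) (by omega)).symm _)

lemma commute_murphyOne_inv (h : IsTL k u v w E) {i : ℕ} (hi : 2 ≤ i) (hik : i < k) :
    Commute (E i) (shift v⁻¹ (E 0) * conjIter u E (shift w⁻¹ (E k)) 1 (k - 1)) :=
  (Commute.shift_right (h.comm (by omega) (by omega)).symm _).mul_right
    (h.commute_conjIter_of_lt _ (fun _ hi => Commute.shift_left (h.comm hi le_rfl).symm w⁻¹) _ _ _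
      le_rfl (by omega) hi hik)

end IsTL

end Abstract

lemma qInt_add_two (u : ℂ) (n : ℕ) :
    qInt u (n + 2) = qInt u n + (u ^ (n + 1) + u⁻¹ ^ (n + 1)) := by
  have h0 : u ^ (((n + 2 : ℕ) : ℤ) - 1 - 2 * ((0 : ℕ) : ℤ)) = u ^ (n + 1) := by
    rw [← zpow_natCast]; congr 1; push_cast; ring
  have h1 : u ^ (((n + 2 : ℕ) : ℤ) - 1 - 2 * ((n + 1 : ℕ) : ℤ)) = u⁻¹ ^ (n + 1) := by
    rw [inv_pow, ← zpow_natCast, ← zpow_neg]; congr 1; push_cast; ring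
  rw [qInt, Finset.sum_range_succ, h1, Finset.sum_range_succ', h0, qInt, add_assoc]
  congr 1
  refine Finset.sum_congr rfl fun j _ => ?_
  congr 1
  push_cast
  ring

namespace IsTL

variable {A : Type*} [Ring A] [Algebra ℂ A] {k : ℕ} {u v w : ℂ} {E : ℕ → A}

theorem sum_murphy_mul_of_even (h : IsTL k u v w E) {n : ℕ} (hk : k = 2 * n + 2) {W W' : ℕ → A}
    (hW : ∀ j, 1 ≤ j → j < k → W (j + 1) = shift u (E j) * W j * shift u (E j))
    (hW' : ∀ j, 1 ≤ j → j < k → W' (j + 1) = shift u⁻¹ (E j) * W' j * shift u⁻¹ (E j))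
    (h1 : W 1 = conjIter u E (shift w (E k)) 1 (k - 1) * shift v (E 0))
    (h1' : W' 1 = shift v⁻¹ (E 0) * conjIter u E (shift w⁻¹ (E k)) 1 (k - 1)) :
    (∑ j ∈ Finset.Icc 1 k, (W j + W' j)) * stepProd E 1 (n + 1) =
      qInt u k • (stepProd E 1 (n + 1) * (shift v⁻¹ (E 0) * stepProd E 2 n * shift w (E k)) *
        stepProd E 1 (n + 1)) := by
  have hu := h.u_ne
  have hv := h.v_ne
  have hw := h.w_ne
  have p := h.murphy_add_murphy_mul_stepProd hW
    (fun i hi hik => h1 ▸ h.commute_murphyOne hi hik) (m := 1) (N := n + 1) le_rfl (by omega)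
  have p' := h.bar.murphy_add_murphy_mul_stepProd hW'
    (fun i hi hik => h1' ▸ h.commute_murphyOne_inv hi hik) (m := 1) (N := n + 1) le_rfl (by omega)
  have d : stepProd E 1 (n + 1) * (shift v (E 0) * stepProd E 2 n * shift w⁻¹ (E k)) *
        stepProd E 1 (n + 1) =
      stepProd E 1 (n + 1) * (shift v⁻¹ (E 0) * stepProd E 2 n * shift w (E k)) *
        stepProd E 1 (n + 1) := by
    -- Both scalars equal `v w u⁻¹ + u v⁻¹ w⁻¹`.
    rw [h.even_sandwich hk, h.even_sandwich hk]
    congr 2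
    field_simp
    ring
  rw [h1, show k - 1 = 2 * n + 1 by omega, h.mul_murphyOne_mul_of_even hk] at p
  rw [h1', show k - 1 = 2 * n + 1 by omega, h.mul_murphyOne_inv_mul_of_even hk, d] at p'
  generalize _ * _ * stepProd E 1 (n + 1) = D at *
  suffices hs : ∀ N ≤ n + 1, (∑ j ∈ Finset.Icc 1 (2 * N), (W j + W' j)) * stepProd E 1 (n + 1) =
      qInt u (2 * N) • D by
    rw [show k = 2 * (n + 1) by omega]
    exact hs (n + 1) le_rfl
  intro N
  induction N with
  | zero => intro _; simp [qInt]
  | succ N ih =>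
    intro hN
    have q := p N (by omega)
    have q' := p' N (by omega)
    rw [show 2 * (N + 1) = 2 * N + 1 + 1 by ring, Finset.sum_Icc_succ_top (by omega),
      Finset.sum_Icc_succ_top (by omega), add_assoc, add_mul, ih (by omega), add_assoc (2 * N),
      qInt_add_two, add_smul]
    congr 1
    rw [show 1 + 2 * N = 2 * N + 1 by ring, add_mul] at q q'
    calc (W (2 * N + 1) + W' (2 * N + 1) + (W (2 * N + 1 + 1) + W' (2 * N + 1 + 1))) *
          stepProd E 1 (n + 1)
        = (W (2 * N + 1) * stepProd E 1 (n + 1) + W (2 * N + 1 + 1) * stepProd E 1 (n + 1)) +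
          (W' (2 * N + 1) * stepProd E 1 (n + 1) + W' (2 * N + 1 + 1) * stepProd E 1 (n + 1)) := by
          simp only [add_mul]; abel
      _ = _ := by
        rw [q, q', smul_smul, smul_smul, ← add_smul]
        congr 1
        simp only [pow_succ, inv_pow, inv_inv]
        field_simp

theorem sum_murphy_mul_of_odd (h : IsTL k u v w E) {n : ℕ} (hk : k = 2 * n + 3) {W W' : ℕ → A}
    (hW : ∀ j, 1 ≤ j → j < k → W (j + 1) = shift u (E j) * W j * shift u (E j))
    (hW' : ∀ j, 1 ≤ j → j < k → W' (j + 1) = shift u⁻¹ (E j) * W' j * shift u⁻¹ (E j))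
    (h1 : W 1 = conjIter u E (shift w (E k)) 1 (k - 1) * shift v (E 0))
    (h1' : W' 1 = shift v⁻¹ (E 0) * conjIter u E (shift w⁻¹ (E k)) 1 (k - 1)) :
    (∑ j ∈ Finset.Icc 1 k, (W j + W' j)) * (stepProd E 2 (n + 1) * E 0) =
      qInt u k • ((stepProd E 2 (n + 1) * E 0) * (stepProd E 1 (n + 1) * E k) *
        (stepProd E 2 (n + 1) * E 0) -
          (v * w⁻¹ + w * v⁻¹) • (stepProd E 2 (n + 1) * E 0)) := by
  have hu := h.u_ne
  have hv := h.v_ne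
  have hw := h.w_ne
  -- The pairs start at `m = 2`, leaving `W_1` unpaired; right multiplication by `E_0` completes the
  -- product to a multiple of `I_2`.
  have p i hi := congrArg (· * E 0) <| h.murphy_add_murphy_mul_stepProd hW
    (fun i hi hik => h1 ▸ h.commute_murphyOne hi hik) (m := 2) (N := n + 1) (by omega) (by omega)
      i hi
  have p' i hi := congrArg (· * E 0) <| h.bar.murphy_add_murphy_mul_stepProd hW'
    (fun i hi hik => h1' ▸ h.commute_murphyOne_inv hi hik) (m := 2) (N := n + 1) (by omega)
      (by omega) i hi
  have b := h.murphyOne_add_inv_mul_of_odd hk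
  have d := h.odd_sandwich hk
  have d' := h.bar.odd_sandwich hk
  have x := h.mul_murphyTwo_mul_of_odd hk
  have x' := h.mul_murphyTwo_inv_mul_of_odd hk
  have hW2 := hW 1 le_rfl (by omega)
  have hW2' := hW' 1 le_rfl (by omega)
  simp only [inv_inv] at d' hW2'
  rw [d] at x
  rw [d', show v⁻¹ * w + w⁻¹ * v = v * w⁻¹ + w * v⁻¹ by ring] at x'
  rw [show k - 1 = 2 * n + 2 by omega] at h1 h1'
  rw [← h1, ← h1'] at b
  rw [← h1, ← hW2] at x
  rw [← h1', ← hW2'] at x'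
  simp only [smul_mul_assoc, mul_assoc _ (stepProd E 2 (n + 1)) (E 0)] at p p'
  simp only [show 1 + 1 = 2 from rfl] at x x'
  simp only [x] at p
  simp only [x'] at p'
  generalize stepProd E 2 (n + 1) * E 0 = I at *
  generalize I * _ * I - _ = D at *
  suffices hs : ∀ N ≤ n + 1, (∑ j ∈ Finset.Icc 1 (2 * N + 1), (W j + W' j)) * I =
      qInt u (2 * N + 1) • D by
    rw [show k = 2 * (n + 1) + 1 by omega]
    exact hs (n + 1) le_rfl
  intro N
  induction N with
  -- The unpaired index 1 supplies the term `[1] = 1`.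
  | zero => intro _; simp [qInt, b]
  | succ N ih =>
    intro hN
    have q := p N (by omega)
    have q' := p' N (by omega)
    rw [show 2 * (N + 1) + 1 = 2 * N + 1 + 1 + 1 by ring, Finset.sum_Icc_succ_top (by omega),
      Finset.sum_Icc_succ_top (by omega), add_assoc, add_mul, ih (by omega), add_assoc (2 * N + 1),
      qInt_add_two, add_smul]
    congr 1
    rw [show 2 + 2 * N = 2 * N + 1 + 1 by ring, add_mul] at q q'
    calc (W (2 * N + 1 + 1) + W' (2 * N + 1 + 1) + (W (2 * N + (1 + 1) + 1) +
          W' (2 * N + (1 + 1) + 1))) * I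
        = (W (2 * N + 1 + 1) * I + W (2 * N + 1 + 1 + 1) * I) +
          (W' (2 * N + 1 + 1) * I + W' (2 * N + 1 + 1 + 1) * I) := by
          simp only [add_mul, ← add_assoc]; abel
      _ = _ := by
        rw [q, q', smul_smul, smul_smul, smul_smul, smul_smul, ← add_smul]
        congr 1
        simp only [pow_succ, inv_pow, inv_inv]
        field_simp

end IsTL
end TwoBoundary

namespace TwoBoundary

/-! ### From the abstract relations to the presented algebra. -/

section Abstract

variable {F A : Type*} [Field F] [Ring A] [Algebra F A]

lemma prod_mul_prod_eq_conjIter (u : F) (E : ℕ → A) (Y : A) (n : ℕ) : ∀ m : ℕ,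
    ((List.range n).map fun i => shift u⁻¹ (E (i + m))).prod * Y *
      ((List.range n).reverse.map fun i => shift u (E (i + m))).prod = conjIter u E Y m n := by
  induction n with
  | zero => intro m; simp [conjIter]
  | succ n ih =>
    intro m
    have h1 : ((fun i => shift u⁻¹ (E (i + m))) ∘ Nat.succ) =
        fun i => shift u⁻¹ (E (i + (m + 1))) := by
      funext i; simp only [Function.comp]; congr 2; omega
    have h2 : ((fun i => shift u (E (i + m))) ∘ Nat.succ) =
        fun i => shift u (E (i + (m + 1))) := by
      funext i; simp only [Function.comp]; congr 2; omega
    rw [conjIter, ← ih (m + 1), List.range_succ_eq_map, List.reverse_cons, List.map_append,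
      List.prod_append, List.map_cons, List.prod_cons, List.map_map, ← List.map_reverse,
      List.map_map, h1, h2]
    simp [mul_assoc]

lemma IsTL.conjIter_mul_conjIter {k : ℕ} {u v w : F} {E : ℕ → A} (h : IsTL k u v w E) {Y Y' : A}
    (hY : Y' * Y = 1) (n : ℕ) : ∀ m, 1 ≤ m → m + n ≤ k →
    conjIter u E Y' m n * conjIter u E Y m n = 1 := by
  induction n with
  | zero => intro m _ _; exact hY
  | succ n ih =>
    intro m hm hk
    have s := h.sq hm (by omega)
    have s1 := shift_mul_shift_inv h.u_ne s
    have s2 := shift_inv_mul_shift h.u_ne s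
    have ih' := ih (m + 1) (by omega) (by omega)
    rw [conjIter, conjIter]
    generalize conjIter u E Y' (m + 1) n = C' at *
    generalize conjIter u E Y (m + 1) n = C at *
    calc shift u⁻¹ (E m) * C' * shift u (E m) * (shift u⁻¹ (E m) * C * shift u (E m))
        = shift u⁻¹ (E m) * C' * (shift u (E m) * shift u⁻¹ (E m)) * C * shift u (E m) := by
          simp only [mul_assoc]
      _ = shift u⁻¹ (E m) * (C' * C) * shift u (E m) := by
          rw [s1]; simp only [mul_assoc, one_mul]
      _ = 1 := by rw [ih', mul_one, s2]

lemma mul_self_of_quadratic {x : F} {e : A}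
    (h : (shift x e - algebraMap F A x) * (shift x e + algebraMap F A x⁻¹) = 0) :
    e * e = -(x + x⁻¹) • e := by
  rw [Algebra.algebraMap_eq_smul_one, Algebra.algebraMap_eq_smul_one, shift,
    add_sub_cancel_right, mul_add, mul_add, mul_smul_comm, mul_smul_comm, mul_one] at h
  rw [neg_smul, eq_neg_iff_add_eq_zero, add_smul, ← h, add_assoc]

lemma Commute.of_shift {x y : F} {e f : A} (h : Commute (shift x e) (shift y f)) :
    Commute e f := by
  have h1 := Commute.shift_left (Commute.shift_right h (-y)) (-x)
  simpa [shift] using h1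

/-- `odd_sandwich` multiplied on the left by the missing `E_0`, which the right-hand side absorbs as
the scalar `-(v + v⁻¹)`, and rewritten with the normalizations of `I_1` and `I_2`. -/
lemma IsTL.odd_sandwich_smul {k : ℕ} {u v w : F} {E : ℕ → A} (h : IsTL k u v w E) {n : ℕ}
    (hk : k = 2 * n + 3) {a b : F} (ha : a ≠ 0) (hb : b ≠ 0) {I J : A}
    (hI : I = b⁻¹ • (stepProd E 1 (n + 1) * E k))
    (hJ : J = a⁻¹ • (stepProd E 2 (n + 1) * E 0)) :
    J * (shift u⁻¹ (E 1) * shift v⁻¹ (E 0) * shift u⁻¹ (E 1) * stepProd E 3 n *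
        shift w (E k)) * J =
      (u⁻¹ * (-(v + v⁻¹) / a)) • ((a * b) • (J * I * J) - (v * w⁻¹ + w * v⁻¹) • J) := by
  have hu := h.u_ne
  have hv := h.v_ne
  have hw := h.w_ne
  have cJ : Commute (E 0) (stepProd E 2 (n + 1)) :=
    commute_stepProd fun j hj => h.comm (by omega) (by omega)
  have sandwich := h.odd_sandwich hk
  have habs : E 0 * (stepProd E 2 (n + 1) * E 0) =
      -(v + v⁻¹) • (stepProd E 2 (n + 1) * E 0) := by
    rw [← cJ.eq, ← mul_assoc, h.sq_zero, smul_mul_assoc]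
  rw [hI, hJ]
  nth_rw 1 [← cJ.eq]
  simp only [smul_mul_assoc, mul_smul_comm]
  rw [mul_assoc (E 0), mul_assoc (E 0), sandwich, mul_smul_comm, mul_sub,
    mul_smul_comm, mul_assoc _ (_ * _) (_ * _), ← mul_assoc (E 0), habs, smul_mul_assoc]
  match_scalars <;> (field_simp; try ring)

end Abstract

section Presentation

variable (p : Params) (k : ℕ)

/-- The image of the braid group in `TL_k`. -/
noncomputable def braidToTL : BraidGroup k →* TL p k :=
  (toTL p k : Hecke p k →* TL p k).comp (toHecke p k)

/-- The rescaled generators `T_i - t_i^{1/2}` of `TL_k`. -/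
noncomputable def gen (i : ℕ) : TL p k := p.scale k i • e p k i

lemma T_eq_braidToTL (i : ℕ) : T p k i = braidToTL p k (σ k i) := rfl

lemma Tinv_eq_braidToTL (i : ℕ) : Tinv p k i = braidToTL p k (σ k i)⁻¹ := rfl

lemma Params.root_ne (i : ℕ) : p.root k i ≠ 0 := by
  unfold Params.root
  split_ifs
  exacts [p.rt0_ne, p.rtk_ne, p.rt_ne]

lemma Params.scale_ne (i : ℕ) : p.scale k i ≠ 0 := by
  unfold Params.scale
  split_ifs
  exacts [p.a0_ne, p.ak_ne, p.a_ne]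

variable {p k}

lemma Params.root_mid {i : ℕ} (h1 : 1 ≤ i) (h2 : i < k) : p.root k i = p.rt := by
  rw [Params.root, if_neg (by omega), if_neg (by omega)]

lemma Params.root_last (hk : 2 ≤ k) : p.root k k = p.rtk := by
  rw [Params.root, if_neg (by omega), if_pos rfl]

lemma Params.scale_mid {i : ℕ} (h1 : 1 ≤ i) (h2 : i < k) : p.scale k i = p.a := by
  rw [Params.scale, if_neg (by omega), if_neg (by omega)]

lemma Params.scale_last (hk : 2 ≤ k) : p.scale k k = p.ak := by
  rw [Params.scale, if_neg (by omega), if_pos rfl]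

variable (p k)

lemma T_eq_shift (i : ℕ) : T p k i = shift (p.root k i) (gen p k i) := by
  rw [gen, e, heckeE, map_smul, map_sub, AlgHom.commutes, smul_smul,
    mul_inv_cancel₀ (p.scale_ne k i), one_smul, shift, Algebra.algebraMap_eq_smul_one, T]
  abel

variable {p k}

lemma gen_sq {i : ℕ} (hi : i ≤ k) :
    gen p k i * gen p k i = -(p.root k i + (p.root k i)⁻¹) • gen p k i := by
  have h0 := congrArg (toTL p k) (RingQuot.mkAlgHom_rel ℂ (HeckeRel.quadratic (p := p) i hi))
  have h1 : (T p k i - algebraMap ℂ _ (p.root k i)) *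
      (T p k i + algebraMap ℂ _ (p.root k i)⁻¹) = 0 := by
    rw [map_zero, map_zero, map_mul, map_sub, map_add, AlgHom.commutes, AlgHom.commutes, map_mul,
      map_sub, map_add, AlgHom.commutes, AlgHom.commutes] at h0
    exact h0
  rw [T_eq_shift] at h1
  exact mul_self_of_quadratic h1

lemma Tinv_eq_shift {i : ℕ} (hi : i ≤ k) :
    Tinv p k i = shift (p.root k i)⁻¹ (gen p k i) := by
  have h1 : Tinv p k i * T p k i = 1 := by
    rw [Tinv_eq_braidToTL, T_eq_braidToTL, ← map_mul, inv_mul_cancel, map_one]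
  refine left_inv_eq_right_inv h1 ?_
  rw [T_eq_shift]
  exact shift_mul_shift_inv (p.root_ne k i) (gen_sq hi)

lemma commute_σ {i j : ℕ} (hij : i + 1 < j) (hj : j ≤ k) : Commute (σ k i) (σ k j) := by
  have h : (.of (Fin.ofNat (k + 1) i) * .of (Fin.ofNat (k + 1) j)) *
      (.of (Fin.ofNat (k + 1) j) * .of (Fin.ofNat (k + 1) i))⁻¹ ∈ braidRelators k := by
    refine ⟨Fin.ofNat (k + 1) i, Fin.ofNat (k + 1) j, Or.inl ⟨?_, rfl⟩⟩
    rw [Fin.val_ofNat, Fin.val_ofNat, Nat.mod_eq_of_lt (by omega), Nat.mod_eq_of_lt (by omega)]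
    exact hij
  have h2 := PresentedGroup.one_of_mem h
  rw [map_mul, map_inv, mul_inv_eq_one, map_mul, map_mul] at h2
  exact h2

lemma commute_gen {i j : ℕ} (hij : i + 1 < j) (hj : j ≤ k) : Commute (gen p k i) (gen p k j) := by
  have h : Commute (T p k i) (T p k j) := (commute_σ hij hj).map (braidToTL p k)
  rw [T_eq_shift, T_eq_shift] at h
  exact Commute.of_shift h

lemma gen_mid {i : ℕ} (h1 : 1 ≤ i) (h2 : i < k) : gen p k i = p.a • e p k i := by
  rw [gen, Params.scale_mid h1 h2]

lemma gen_zero : gen p k 0 = p.a0 • e p k 0 := rfl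

lemma gen_last (hk : 2 ≤ k) : gen p k k = p.ak • e p k k := by
  rw [gen, Params.scale_last hk]

lemma ae_eq_gen {i : ℕ} (h1 : 1 ≤ i) (h2 : i < k) : ae p k i = gen p k i := (gen_mid h1 h2).symm

lemma aeProd_eq_stepProd {m n : ℕ} (hm : 1 ≤ m) (h : m + 2 * n < k + 2) :
    aeProd p k m n = stepProd (gen p k) m n :=
  stepProd_congr (E := ae p k) fun _ _ => ae_eq_gen (by omega) (by omega)

/-- The braid group contributes only its far commutations; the rest is the quadratic and
Temperley-Lieb relations with the constants `a`, `a_0`, `a_k` absorbed into the generators. -/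
lemma isTL_gen (hk : 2 ≤ k) : IsTL k p.rt p.rt0 p.rtk (gen p k) where
  u_ne := p.rt_ne
  v_ne := p.rt0_ne
  w_ne := p.rtk_ne
  comm := commute_gen
  sq := fun h1 h2 => by rw [gen_sq h2.le, Params.root_mid h1 h2]
  sq_zero := gen_sq (Nat.zero_le k)
  sq_last := by rw [gen_sq le_rfl, Params.root_last hk]
  left := by
    have h := RingQuot.mkAlgHom_rel ℂ (TLRel.left (p := p) (k := k))
    simp only [map_smul, map_mul] at h
    change _ • (e p k 1 * e p k 0 * e p k 1) = _ • e p k 1 at h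
    rw [bracket, mul_inv, inv_inv] at h
    rw [gen_mid le_rfl hk, gen_zero]
    simp only [smul_mul_assoc, mul_smul_comm, smul_smul]
    convert h using 2 <;> ring
  right := by
    have h := RingQuot.mkAlgHom_rel ℂ (TLRel.right (p := p) (k := k))
    simp only [map_smul, map_mul] at h
    change _ • (e p k (k - 1) * e p k k * e p k (k - 1)) = _ • e p k (k - 1) at h
    rw [bracket, mul_inv, inv_inv] at h
    rw [gen_mid (by omega) (by omega), gen_last hk]
    simp only [smul_mul_assoc, mul_smul_comm, smul_smul]
    convert h using 2 <;> ring
  up := fun {i} h1 h2 => by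
    have h := RingQuot.mkAlgHom_rel ℂ (TLRel.up (p := p) (k := k) i h1 h2)
    simp only [map_smul, map_mul] at h
    change _ • (e p k i * e p k (i + 1) * e p k i) = _ • e p k i at h
    rw [gen_mid h1 (by omega), gen_mid (by omega) (by omega)]
    simp only [smul_mul_assoc, mul_smul_comm, smul_smul]
    refine Eq.trans ?_ h
    congr 1; ring
  down := fun {i} h1 h2 => by
    have h := RingQuot.mkAlgHom_rel ℂ (TLRel.down (p := p) (k := k) i h1 h2)
    simp only [map_smul, map_mul] at h
    change _ • (e p k (i + 1) * e p k i * e p k (i + 1)) = _ • e p k (i + 1) at h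
    rw [gen_mid h1 (by omega), gen_mid (by omega) (by omega)]
    simp only [smul_mul_assoc, mul_smul_comm, smul_smul]
    refine Eq.trans ?_ h
    congr 1; ring

variable (p k) in
lemma Z_eq_sum : Z p k = ∑ j ∈ Finset.Icc 1 k,
    (braidToTL p k (murphy k j) + braidToTL p k (murphy k j)⁻¹) := by
  rw [Z, heckeZ, map_sum]
  exact Finset.sum_congr rfl fun j _ => map_add _ _ _

lemma T_mid {i : ℕ} (h1 : 1 ≤ i) (h2 : i < k) : T p k i = shift p.rt (gen p k i) := by
  rw [T_eq_shift, Params.root_mid h1 h2]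

lemma Tinv_mid {i : ℕ} (h1 : 1 ≤ i) (h2 : i < k) : Tinv p k i = shift p.rt⁻¹ (gen p k i) := by
  rw [Tinv_eq_shift h2.le, Params.root_mid h1 h2]

lemma T_last (hk : 2 ≤ k) : T p k k = shift p.rtk (gen p k k) := by
  rw [T_eq_shift, Params.root_last hk]

lemma braidToTL_murphy_succ {j : ℕ} (h1 : 1 ≤ j) (h2 : j < k) :
    braidToTL p k (murphy k (j + 1)) = shift p.rt (gen p k j) * braidToTL p k (murphy k j) *
      shift p.rt (gen p k j) := by
  obtain ⟨j, rfl⟩ : ∃ l, j = l + 1 := ⟨j - 1, by omega⟩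
  rw [murphy, map_mul, map_mul, ← T_eq_braidToTL, T_mid h1 h2]

lemma braidToTL_murphy_inv_succ {j : ℕ} (h1 : 1 ≤ j) (h2 : j < k) :
    braidToTL p k (murphy k (j + 1))⁻¹ = shift p.rt⁻¹ (gen p k j) *
      braidToTL p k (murphy k j)⁻¹ * shift p.rt⁻¹ (gen p k j) := by
  obtain ⟨j, rfl⟩ : ∃ l, j = l + 1 := ⟨j - 1, by omega⟩
  rw [murphy, mul_inv_rev, mul_inv_rev, ← mul_assoc, map_mul, map_mul, ← Tinv_eq_braidToTL,
    Tinv_mid h1 h2]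

lemma braidToTL_murphy_one (hk : 2 ≤ k) :
    braidToTL p k (murphy k 1) = conjIter p.rt (gen p k) (shift p.rtk (gen p k k)) 1 (k - 1) *
      shift p.rt0 (gen p k 0) := by
  have h1 : (List.range (k - 1)).map (braidToTL p k ∘ fun i => (σ k (i + 1))⁻¹) =
      (List.range (k - 1)).map fun i => shift p.rt⁻¹ (gen p k (i + 1)) :=
    List.map_congr_left fun i hi =>
      Tinv_mid (by omega) (by have := List.mem_range.1 hi; omega)
  have h2 : (List.range (k - 1)).reverse.map (braidToTL p k ∘ fun i => σ k (i + 1)) =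
      (List.range (k - 1)).reverse.map fun i => shift p.rt (gen p k (i + 1)) :=
    List.map_congr_left fun i hi =>
      T_mid (by omega) (by have := List.mem_range.1 (List.mem_reverse.1 hi); omega)
  rw [murphy, murphyOne, map_mul, map_mul, map_mul, map_list_prod, map_list_prod, List.map_map,
    List.map_map, h1, h2, ← T_eq_braidToTL, ← T_eq_braidToTL, T_last hk, T_eq_shift,
    prod_mul_prod_eq_conjIter]
  rfl

lemma braidToTL_murphy_inv_one (hk : 2 ≤ k) :
    braidToTL p k (murphy k 1)⁻¹ = shift p.rt0⁻¹ (gen p k 0) *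
      conjIter p.rt (gen p k) (shift p.rtk⁻¹ (gen p k k)) 1 (k - 1) := by
  have h := isTL_gen (p := p) hk
  have h1 : braidToTL p k (murphy k 1) * braidToTL p k (murphy k 1)⁻¹ = 1 := by
    rw [← map_mul, mul_inv_cancel, map_one]
  refine (left_inv_eq_right_inv ?_ h1).symm
  rw [braidToTL_murphy_one hk, mul_assoc, ← mul_assoc (conjIter _ _ _ _ _),
    h.conjIter_mul_conjIter (shift_inv_mul_shift h.w_ne h.sq_last) _ _ le_rfl (by omega), one_mul,
    shift_inv_mul_shift h.v_ne h.sq_zero]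

end Presentation

end TwoBoundary

open TwoBoundary in
theorem theorem3p2 (k : ℕ) (hk : 2 ≤ k) (p : Params) :
    (Even k →
      Deven p k =
          (p.a0 * p.ak) • (I₁ p k * I₂ p k * I₁ p k)
            + bracket (p.rt0 * p.rtk * p.rt⁻¹) • I₁ p k ∧
        Z p k * I₁ p k = qInt p.rt k • Deven p k) ∧
    (Odd k →
      Dodd p k =
          (p.rt⁻¹ * (-bracket p.rt0 / p.a0)) •
            ((p.a0 * p.ak) • (I₂ p k * I₁ p k * I₂ p k)
              - bracket (p.rt0 * p.rtk⁻¹) • I₂ p k) ∧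
        (p.rt⁻¹ * (-bracket p.rt0 / p.a0)) • (Z p k * I₂ p k) = qInt p.rt k • Dodd p k) := by
  have h := isTL_gen (p := p) hk
  have hu := p.rt_ne
  have hv := p.rt0_ne
  have hw := p.rtk_ne
  have ha0 := p.a0_ne
  have hak := p.ak_ne
  have e0 : e p k 0 = p.a0⁻¹ • gen p k 0 := by
    rw [gen_zero, smul_smul, inv_mul_cancel₀ ha0, one_smul]
  have ek : e p k k = p.ak⁻¹ • gen p k k := by
    rw [gen_last hk, smul_smul, inv_mul_cancel₀ hak, one_smul]
  have t0 : Tinv p k 0 = shift p.rt0⁻¹ (gen p k 0) := Tinv_eq_shift (Nat.zero_le k)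
  refine ⟨fun hev => ?_, fun hodd => ?_⟩
  · obtain ⟨n, hn⟩ : ∃ n, k = 2 * n + 2 := by
      obtain ⟨m, rfl⟩ := hev
      exact ⟨m - 1, by omega⟩
    have hI : I₁ p k = stepProd (gen p k) 1 (n + 1) := by
      rw [I₁, if_pos hev, show k / 2 = n + 1 by omega, aeProd_eq_stepProd le_rfl (by omega)]
    have hD : Deven p k = stepProd (gen p k) 1 (n + 1) * (shift p.rt0⁻¹ (gen p k 0) *
        stepProd (gen p k) 2 n * shift p.rtk (gen p k k)) * stepProd (gen p k) 1 (n + 1) := by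
      rw [Deven, hI, t0, T_last hk, show k / 2 - 1 = n by omega,
        aeProd_eq_stepProd (by omega) (by omega)]
    refine ⟨?_, ?_⟩
    · rw [hD, h.even_sandwich hn, hI, I₂, if_pos hev, show k / 2 - 1 = n by omega,
        aeProd_eq_stepProd (by omega) (by omega), e0, ek, bracket]
      simp only [smul_mul_assoc, mul_smul_comm, smul_smul]
      congr 2
      · rw [show p.a0 * p.ak * (p.ak⁻¹ * p.a0⁻¹) = 1 by field_simp, one_smul]
      · field_simp
        ring
    · rw [Z_eq_sum, hD, hI]
      exact h.sum_murphy_mul_of_even hn (W := fun j => braidToTL p k (murphy k j))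
        (W' := fun j => braidToTL p k (murphy k j)⁻¹) (fun j => braidToTL_murphy_succ)
        (fun j => braidToTL_murphy_inv_succ) (braidToTL_murphy_one hk) (braidToTL_murphy_inv_one hk)
  · have hev : ¬Even k := Nat.not_even_iff_odd.2 hodd
    obtain ⟨n, hn⟩ : ∃ n, k = 2 * n + 3 := by
      obtain ⟨m, rfl⟩ := hodd
      exact ⟨m - 1, by omega⟩
    have hI1 : I₁ p k = p.ak⁻¹ • (stepProd (gen p k) 1 (n + 1) * gen p k k) := by
      rw [I₁, if_neg hev, show k / 2 = n + 1 by omega, aeProd_eq_stepProd le_rfl (by omega), ek,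
        mul_smul_comm]
    have cJ : Commute (gen p k 0) (stepProd (gen p k) 2 (n + 1)) :=
      commute_stepProd fun j hj => h.comm (by omega) (by omega)
    have hI2 : I₂ p k = p.a0⁻¹ • (stepProd (gen p k) 2 (n + 1) * gen p k 0) := by
      rw [I₂, if_neg hev, show k / 2 = n + 1 by omega, aeProd_eq_stepProd (by omega) (by omega), e0,
        smul_mul_assoc, cJ.eq]
    have hsum := h.sum_murphy_mul_of_odd hn (W := fun j => braidToTL p k (murphy k j))
      (W' := fun j => braidToTL p k (murphy k j)⁻¹) (fun j => braidToTL_murphy_succ)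
      (fun j => braidToTL_murphy_inv_succ) (braidToTL_murphy_one hk) (braidToTL_murphy_inv_one hk)
    rw [← Z_eq_sum] at hsum
    have hD : Dodd p k = (p.rt⁻¹ * (-bracket p.rt0 / p.a0)) •
        ((p.a0 * p.ak) • (I₂ p k * I₁ p k * I₂ p k) - bracket (p.rt0 * p.rtk⁻¹) • I₂ p k) := by
      rw [Dodd, t0, T_last hk, Tinv_mid le_rfl (by omega), show k / 2 - 1 = n by omega,
        aeProd_eq_stepProd (by omega) (by omega), bracket, bracket, mul_inv, inv_inv,
        mul_comm p.rt0⁻¹]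
      exact h.odd_sandwich_smul hn ha0 hak hI1 hI2
    refine ⟨hD, ?_⟩
    -- The common prefactor is stripped from both sides, so the identity proved is the one without
    -- it, valid even if `⟦t_0⟧ = 0`.
    rw [hD, smul_comm (qInt p.rt k)]
    congr 1
    rw [hI1, hI2, mul_smul_comm, hsum, smul_comm, bracket]
    congr 1
    simp only [smul_mul_assoc, mul_smul_comm]
    match_scalars <;> field_simp
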